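/- Nodes are points of the Euclidean plane. A link $i$ has a sender $s_i$, a receiver $r_i$ and length $l_i=d(s_i,r_i)$. Fix a path-loss exponent $\alpha>2$, an SINR threshold $\beta>0$ and $\epsilon>0$, and let $N\ge 0$ be the ambient noise. Given powers $P(i)>0$, a set $S$ of links is $P$-feasible if for every $i\in S$ $$\frac{P(i)}{l_i^{\alpha}}\ \ge\ \beta\Big(\sum_{j\in S\setminus\{i\}}\frac{P(j)}{d(s_j,r_i)^{\alpha}}+N\Big)$$ (where a term with $s_j=r_i$ counts as $+\infty$). The links of $S$ are interference limited under $P$ if $P(i)\ge(1+\epsilon)\beta N l_i^{\alpha}$ for all $i\in S$. A set of links can be scheduled in $m$ slots with global power control if it can be partitioned into at most $m$ sets, each of which is $P$-feasible for some $P>0$ under which it is interference limited. It can be scheduled in $m$ slots with the oblivious power scheme $P_\tau$ if, for every $C>0$ such that it is interference limited under $P_\tau(i)=C\,l_i^{\tau\alpha}$, it can be partitioned into at most $m$ $P_\tau$-feasible sets. Finally, $\log^* x$ is the least number of times that $\log_2$ has to be applied to $x$ to reach a value at most $1$. **Corollary (random deployments).** For all $\alpha>2$, $\beta>0$, $\epsilon>0$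 there are constants $\tau\in(0,1)$ and $K>0$ such that for all $n\ge 3$, $a>0$ and $N\ge 0$ the following holds. Place $n$ nodes independently and uniformly at random in a square of side $a$, or in a disk of radius $a$. Then, with probability at least $1-K/n^2$, for every Euclidean minimum spanning tree $T$ of the nodes and every orientation of the edges of $T$, the resulting links can be scheduled in at most $K\log^* n$ slots with global power control, and in at most $K\log\log n$ slots with the oblivious power scheme $P_\tau$. -/

import Mathlib

/-- The Euclidean plane. -/
abbrev Plane : Type := EuclideanSpace ℝ (Fin 2)

/-! ### Iterated logarithm -/

theorem exists_iterate_logb_le_one (x : ℝ) : ∃ k : ℕ, (Real.logb 2)^[k] x ≤ 1 := by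
  have key : ∀ m : ℕ, ∀ y : ℝ, y ≤ m + 1 → ∃ k : ℕ, (Real.logb 2)^[k] y ≤ 1 := by
    intro m
    induction m with
    | zero => intro y hy; exact ⟨0, by simpa using hy⟩
    | succ m ih =>
      intro y hy
      by_cases h1 : y ≤ 1
      · exact ⟨0, by simpa using h1⟩
      push Not at h1
      by_cases h2 : y ≤ 2
      · refine ⟨1, ?_⟩
        have := (Real.logb_le_iff_le_rpow (b := 2) (x := y) (y := 1) (by norm_num)
          (by linarith)).2 (by simpa using h2)
        simpa using this
      push Not at h2
      have hlog : Real.logb 2 y ≤ y - 1 := by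
        have hs := one_add_mul_self_le_rpow_one_add (s := 1) (p := y - 1) (by norm_num)
          (by linarith)
        rw [Real.logb_le_iff_le_rpow (by norm_num) (by linarith)]
        norm_num at hs
        linarith
      obtain ⟨k, hk⟩ := ih (Real.logb 2 y) (by push_cast at hy; linarith)
      exact ⟨k + 1, by simpa [Function.iterate_succ_apply] using hk⟩
  obtain ⟨m, hm⟩ := exists_nat_ge x
  exact key m x (by linarith)

open Classical in
/-- `log* x`: the least number of times that the binary logarithm has to be applied to `x`
to reach a value that is at most `1`. -/
noncomputable def logStar (x : ℝ) : ℕ := Nat.find (exists_iterate_logb_le_one x)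

/-! ### Links, power assignments and feasibility in the physical (SINR) model -/

/-- A communication link, from a sender to a receiver. -/
structure Link where
  sender : Plane
  receiver : Plane

/-- The length `l_i` of a link. -/
noncomputable def Link.length (l : Link) : ℝ := dist l.sender l.receiver

open Classical in
/-- The set `S` of links of the family `L` is `P`-feasible: every link `i ∈ S` satisfies
`P i / l_i ^ α ≥ β (∑_{j ∈ S, j ≠ i} P j / d (s_j, r_i) ^ α + N)`.
A link whose sender sits on the receiver of another link `i` causes infinite interference on
`i`; as division by zero is `0` here, this case is ruled out explicitly. -/
def FeasibleWith {ι : Type*} (α β N : ℝ) (L : ι → Link) (P : ι → ℝ) (S : Finset ι) : Prop :=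
  ∀ i ∈ S,
    (∀ j ∈ S, j ≠ i → (L j).sender ≠ (L i).receiver) ∧
    β * ((∑ j ∈ S.erase i, P j / dist (L j).sender (L i).receiver ^ α) + N)
      ≤ P i / (L i).length ^ α

/-- The links in `S` are interference limited under the power assignment `P`. -/
def InterferenceLimited {ι : Type*} (α β N ε : ℝ) (L : ι → Link) (P : ι → ℝ) (S : Finset ι) :
    Prop :=
  ∀ i ∈ S, (1 + ε) * β * N * (L i).length ^ α ≤ P i

/-- The set `S` of links is feasible: some (interference limited) assignment of positive
power levels makes it feasible. -/
def Feasible {ι : Type*} (α β N ε : ℝ) (L : ι → Link) (S : Finset ι) : Prop :=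
  ∃ P : ι → ℝ, (∀ i, 0 < P i) ∧ InterferenceLimited α β N ε L P S ∧ FeasibleWith α β N L P S

/-- The oblivious power scheme `P_τ (i) = C l_i ^ (τ α)`. -/
noncomputable def obliviousPower {ι : Type*} (α τ C : ℝ) (L : ι → Link) (i : ι) : ℝ :=
  C * (L i).length ^ (τ * α)

open Classical in
/-- The links (indexed by `ι`) can be partitioned into `m` (possibly empty) slots, each of which
satisfies the property `F`. -/
def SchedulableIn {ι : Type*} [Fintype ι] (F : Finset ι → Prop) (m : ℕ) : Prop :=
  ∃ c : ι → Fin m, ∀ t : Fin m, F (Finset.univ.filter fun i => c i = t)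

/-- All links of `L` can be scheduled in `m` slots with global power control. -/
def GlobalSchedule {ι : Type*} [Finite ι] (α β N ε : ℝ) (L : ι → Link) (m : ℕ) : Prop :=
  letI := Fintype.ofFinite ι
  SchedulableIn (Feasible α β N ε L) m

/-- All links of `L` can be scheduled in `m` slots with the oblivious power scheme `P_τ`, for
every value of its constant `C > 0` for which `L` is interference limited. -/
def ObliviousSchedule {ι : Type*} [Finite ι] (α β N ε τ : ℝ) (L : ι → Link) (m : ℕ) : Prop :=
  letI := Fintype.ofFinite ι
  ∀ C : ℝ, 0 < C → InterferenceLimited α β N ε L (obliviousPower α τ C L) Finset.univ →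
    SchedulableIn (FeasibleWith α β N L (obliviousPower α τ C L)) m

/-! ### Euclidean minimum spanning trees -/

/-- The Euclidean length of the edge `{u, v}` when node `u` is placed at `x u`. -/
noncomputable def edgeLength {n : ℕ} (x : Fin n → Plane) : Sym2 (Fin n) → ℝ :=
  Sym2.lift ⟨fun u v => dist (x u) (x v), fun u v => dist_comm (x u) (x v)⟩

open Classical in
/-- The total edge length of a graph on the nodes. -/
noncomputable def totalLength {n : ℕ} (x : Fin n → Plane) (T : SimpleGraph (Fin n)) : ℝ :=
  ∑ e with e ∈ T.edgeSet, edgeLength x e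

/-- `T` is a minimum spanning tree of the nodes placed at `x`. -/
def IsMST {n : ℕ} (x : Fin n → Plane) (T : SimpleGraph (Fin n)) : Prop :=
  T.IsTree ∧ ∀ T' : SimpleGraph (Fin n), T'.IsTree → totalLength x T ≤ totalLength x T'

/-- `o` orients every edge of `T`: it lists its two ends as (sender, receiver). -/
def IsOrientation {n : ℕ} (T : SimpleGraph (Fin n)) (o : T.edgeSet → Fin n × Fin n) : Prop :=
  ∀ e : T.edgeSet, s((o e).1, (o e).2) = (e : Sym2 (Fin n))

/-- The links obtained from an orientation `o` of the edges of `T`. -/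
def treeLinks {n : ℕ} (x : Fin n → Plane) (T : SimpleGraph (Fin n))
    (o : T.edgeSet → Fin n × Fin n) : T.edgeSet → Link :=
  fun e => ⟨x (o e).1, x (o e).2⟩

/-! ### Random deployments -/

/-- `Q` is a (closed) square of side `a`, in any position. -/
def IsSquareOfSide (a : ℝ) (Q : Set Plane) : Prop :=
  ∃ φ : Plane ≃ᵢ Plane, Q = φ '' {x | ∀ i, x i ∈ Set.Icc 0 a}

/-- `Q` is a (closed) disk of radius `a`. -/
def IsDiskOfRadius (a : ℝ) (Q : Set Plane) : Prop :=
  ∃ p : Plane, Q = Metric.closedBall p a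

/-- The law of `n` independent points, each uniformly distributed in the region `Q`. -/
noncomputable def uniformDeployment (n : ℕ) (Q : Set Plane) :
    MeasureTheory.Measure (Fin n → Plane) :=
  MeasureTheory.Measure.pi fun _ => ProbabilityTheory.cond MeasureTheory.volume Q

/-! ### Minimum spanning trees are well spread -/

/-! Randomness enters only through the spread of the lengths. Two given nodes are closer than a/n²
with probability at most 4/n⁴, so by a union bound all distances lie between a/n² and 2a except with
probability 4/n² (`uniformDeployment_bad_le`). Any two tree edges then have length ratio at most 2n²
≤ n³, and the rest is deterministic.

The exchange property of a minimum spanning tree prevents two edges from nearly coincide in the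
sense of `SparseLinks` (`IsMST.sparseLinks`). A packing argument in position and direction then
shows that only O(R²) links of length at least l have an end within R·l of a point
(`SparseLinks.card_le`). Since α > 2, sums of d^(-α) over such links converge.

Call links f-independent if any two, of lengths l ≤ l', are at distance more than l·f(l'/l). For
f(x) = γ(1 + log x)^p with p = 2/(α-2), shorter links interfere so little that powers set greedily
from the longest link down work (`exists_global_feasible`). For f(x) = γx^δ with suitable δ < 1, a
fixed P_τ works (`exists_oblivious_feasible`).

A greedy colouring, longest links first, splits the links into f-independent classes. The number of
colours is governed by the number of longer links in conflict with a given one. These are grouped by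
length ratio, each group being bounded by packing (`SparseLinks.exists_partition`). Ratios up to n³
need O(log* n) groups for the logarithmic f, because one group leads from T to 2^T, and O(log log n)
groups for the power f, because one group leads from y to y^(1/δ). -/

/-- The two ends of a link: the sender for `true` and the receiver for `false`. -/
def Link.pt (l : Link) (b : Bool) : Plane := if b then l.sender else l.receiver

theorem Link.dist_pt (l : Link) (b : Bool) : dist (l.pt b) (l.pt !b) = l.length := by
  cases b <;> simp [Link.pt, Link.length, dist_comm]

/-- A family of links of positive length such that no two of them nearly coincide. -/
structure SparseLinks {ι : Type*} (L : ι → Link) : Prop where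
  pos : ∀ i, 0 < (L i).length
  sep : ∀ i j, i ≠ j → ∀ b b',
    (L i).length ≤ max (dist ((L i).pt b) ((L j).pt b')) (dist ((L i).pt !b) ((L j).pt !b'))

theorem edgeLength_nonneg {n : ℕ} (x : Fin n → Plane) (e : Sym2 (Fin n)) :
    0 ≤ edgeLength x e := by
  induction e using Sym2.ind with
  | _ u v => exact dist_nonneg (x := x u) (y := x v)

theorem totalLength_le_of_subset {n : ℕ} (x : Fin n → Plane) {T H : SimpleGraph (Fin n)}
    {f : Sym2 (Fin n)} (h : ∀ e ∈ T.edgeSet, e ∈ H.edgeSet ∨ e = f) :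
    totalLength x T ≤ totalLength x H + edgeLength x f := by
  classical
  unfold totalLength
  calc _ ≤ ∑ e ∈ (Finset.univ.filter fun e => e ∈ H.edgeSet) ∪ {f}, edgeLength x e := by
        apply Finset.sum_le_sum_of_subset_of_nonneg
        · intro e he
          simpa [or_comm] using h e (by simpa using he)
        · intros; exact edgeLength_nonneg x _
    _ ≤ _ := by
        refine (Finset.sum_union_inter (s₁ := Finset.univ.filter fun e => e ∈ H.edgeSet)
          (s₂ := {f}) (f := edgeLength x)).le.trans' ?_ |>.trans ?_
        · exact le_add_of_nonneg_right (Finset.sum_nonneg fun _ _ => edgeLength_nonneg x _)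
        · rw [Finset.sum_singleton]

theorem reachable_deleteEdges_or {V : Type*} {T : SimpleGraph V} (hT : T.Preconnected)
    (u v w : V) :
    (T.deleteEdges {s(u, v)}).Reachable u w ∨ (T.deleteEdges {s(u, v)}).Reachable v w := by
  suffices h : ∀ z (p : T.Walk w z), z = u → (T.deleteEdges {s(u, v)}).Reachable u w ∨
      (T.deleteEdges {s(u, v)}).Reachable v w by
    obtain ⟨p⟩ := hT w u
    exact h u p rfl
  intro z p hz
  induction p with
  | nil => exact Or.inl (hz ▸ SimpleGraph.Reachable.refl _)
  | @cons a b _ hab p ih =>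
    by_cases he : s(a, b) = s(u, v)
    · rcases Sym2.eq_iff.1 he with ⟨rfl, rfl⟩ | ⟨rfl, rfl⟩
      · exact Or.inl (SimpleGraph.Reachable.refl _)
      · exact Or.inr (SimpleGraph.Reachable.refl _)
    · have hadj : (T.deleteEdges {s(u, v)}).Adj b a := by
        rw [SimpleGraph.deleteEdges_adj]
        exact ⟨hab.symm, by rwa [Sym2.eq_swap (a := b), Set.mem_singleton_iff]⟩
      exact (ih hz).imp (fun h => h.trans hadj.reachable) (fun h => h.trans hadj.reachable)

/-- Exchange argument: replacing the edge uv by ww' reconnects the two components. A spanning tree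
of the new graph is no longer than that graph, which suffices, so the new graph need not be shown to
be a tree. -/
theorem IsMST.dist_le_of_reachable {n : ℕ} {x : Fin n → Plane} {T : SimpleGraph (Fin n)}
    (hT : IsMST x T) {u v w w' : Fin n} (huv : T.Adj u v)
    (hw : (T.deleteEdges {s(u, v)}).Reachable u w)
    (hw' : (T.deleteEdges {s(u, v)}).Reachable v w') :
    dist (x u) (x v) ≤ dist (x w) (x w') := by
  classical
  set H := T.deleteEdges {s(u, v)} with hH
  have hbr : ¬ H.Reachable u v := by
    have := SimpleGraph.isAcyclic_iff_forall_isBridge.1 hT.1.isAcyclic (e := s(u, v))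
      (by simpa using huv)
    simpa [SimpleGraph.isBridge_iff] using this
  have hne : w ≠ w' := by
    rintro rfl
    exact hbr (hw.trans hw'.symm)
  have hle : H ≤ H ⊔ SimpleGraph.edge w w' := le_sup_left
  have huv' : (H ⊔ SimpleGraph.edge w w').Reachable u v := by
    refine ((hw.mono hle).trans ?_).trans (hw'.mono hle).symm
    apply SimpleGraph.Adj.reachable
    right
    rw [SimpleGraph.edge_adj]
    exact ⟨Or.inl ⟨rfl, rfl⟩, hne⟩
  have hu : ∀ z, (H ⊔ SimpleGraph.edge w w').Reachable u z := by
    intro z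
    rcases reachable_deleteEdges_or hT.1.connected.preconnected u v z with h | h
    · exact h.mono hle
    · exact huv'.trans (h.mono hle)
  have hconn : (H ⊔ SimpleGraph.edge w w').Connected :=
    { preconnected := fun a b => (hu a).symm.trans (hu b)
      nonempty := ⟨u⟩ }
  obtain ⟨T', hT', htree⟩ := hconn.exists_isTree_le
  have h1 := hT.2 T' htree
  have h2 : totalLength x T' ≤ totalLength x H + edgeLength x s(w, w') := by
    apply totalLength_le_of_subset
    intro e he
    have := SimpleGraph.edgeSet_mono hT' he
    rw [SimpleGraph.edgeSet_sup] at this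
    refine this.imp id fun h => ?_
    simpa using (SimpleGraph.edgeSet_edge_of_ne hne).le h
  have h3 : totalLength x T = totalLength x H + edgeLength x s(u, v) := by
    unfold totalLength
    have : (Finset.univ.filter fun e => e ∈ T.edgeSet)
        = insert s(u, v) (Finset.univ.filter fun e => e ∈ H.edgeSet) := by
      ext e
      simp only [hH, SimpleGraph.edgeSet_deleteEdges, Finset.mem_filter, Finset.mem_univ,
        true_and, Finset.mem_insert, Set.mem_sdiff, Set.mem_singleton_iff]
      constructor
      · intro h
        by_cases h' : e = s(u, v)
        · exact Or.inl h'
        · exact Or.inr ⟨h, h'⟩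
      · rintro (rfl | h)
        · simpa using huv
        · exact h.1
    have hnot : s(u, v) ∉ Finset.univ.filter fun e => e ∈ H.edgeSet := by
      simp [hH]
    rw [this, Finset.sum_insert hnot, add_comm]
    congr!
  have h4 : edgeLength x s(u, v) ≤ edgeLength x s(w, w') := by linarith
  exact h4

/-- Were both paired distances shorter than the edge e, the exchange property would put each end of
f in the component of its partner in T - e. Then f would join the two components, although e is a
bridge. -/
theorem IsMST.sparseLinks {n : ℕ} {x : Fin n → Plane} (hx : Function.Injective x)
    {T : SimpleGraph (Fin n)} (hT : IsMST x T) {o : T.edgeSet → Fin n × Fin n}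
    (ho : IsOrientation T o) : SparseLinks (treeLinks x T o) := by
  have hadj : ∀ e, T.Adj (o e).1 (o e).2 := fun e => by
    rw [← SimpleGraph.mem_edgeSet, ho e]
    exact e.2
  let q : T.edgeSet → Bool → Fin n := fun e b => if b then (o e).1 else (o e).2
  have hq : ∀ e b, (treeLinks x T o e).pt b = x (q e b) := by
    intro e b
    cases b <;> rfl
  have hqe : ∀ e b, s(q e b, q e !b) = (e : Sym2 (Fin n)) := by
    intro e b
    rw [← ho e]
    cases b <;> simp [q, Sym2.eq_swap]
  refine ⟨fun e => ?_, fun e f hef b b' => ?_⟩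
  · exact dist_pos.2 (hx.ne (hadj e).ne)
  · rw [← Link.dist_pt _ b]
    simp only [hq]
    have hqadj : ∀ e b, T.Adj (q e b) (q e !b) := by
      intro e b
      rw [← SimpleGraph.mem_edgeSet, hqe]
      exact e.2
    by_contra hlt
    rw [not_le, max_lt_iff] at hlt
    have key := fun w w' h h' => hT.dist_le_of_reachable (w := w) (w' := w') (hqadj e b) h h'
    have h1 : (T.deleteEdges {s(q e b, q e !b)}).Reachable (q e b) (q f b') := by
      rcases reachable_deleteEdges_or hT.1.connected.preconnected (q e b) (q e !b) (q f b')
        with h | h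
      · exact h
      · exact absurd (key _ _ (SimpleGraph.Reachable.refl _) h) (not_le.2 hlt.1)
    have h2 : (T.deleteEdges {s(q e b, q e !b)}).Reachable (q e !b) (q f !b') := by
      rcases reachable_deleteEdges_or hT.1.connected.preconnected (q e b) (q e !b) (q f !b')
        with h | h
      · have := key _ _ h (SimpleGraph.Reachable.refl _)
        rw [dist_comm (x (q f !b'))] at this
        exact absurd this (not_le.2 hlt.2)
      · exact h
    have h3 : (T.deleteEdges {s(q e b, q e !b)}).Adj (q f b') (q f !b') := by
      rw [SimpleGraph.deleteEdges_adj, hqe, hqe]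
      refine ⟨hqadj f b', fun h => hef ?_⟩
      exact (Subtype.ext h).symm
    have hbr := SimpleGraph.isAcyclic_iff_forall_isBridge.1 hT.1.isAcyclic
      (e := s(q e b, q e !b)) (by simpa using hqadj e b)
    rw [SimpleGraph.isBridge_iff] at hbr
    exact hbr ((h1.trans h3.reachable).trans h2.symm)

/-! ### Packing -/

/-- The cell of the square grid of mesh `h` that contains `v`. -/
noncomputable def gridCell (h : ℝ) (v : Plane) : ℤ × ℤ := (⌊v 0 / h⌋, ⌊v 1 / h⌋)

theorem dist_lt_of_gridCell_eq {h : ℝ} (hh : 0 < h) {v w : Plane}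
    (hvw : gridCell h v = gridCell h w) : dist v w < 2 * h := by
  have key : ∀ i : Fin 2, ⌊v i / h⌋ = ⌊w i / h⌋ → |v i - w i| < h := by
    intro i hi
    have := Int.abs_sub_lt_one_of_floor_eq_floor hi
    rwa [← sub_div, abs_div, abs_of_pos hh, div_lt_one hh] at this
  have h0 := key 0 (congrArg Prod.fst hvw)
  have h1 := key 1 (congrArg Prod.snd hvw)
  rw [EuclideanSpace.dist_eq, Real.sqrt_lt' (by linarith), Fin.sum_univ_two, Real.dist_eq,
    Real.dist_eq]
  nlinarith [abs_nonneg (v 0 - w 0), abs_nonneg (v 1 - w 1)]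

theorem gridCell_mem {h : ℝ} (hh : 0 < h) {v : Plane} {m : ℕ} (hv : ‖v‖ ≤ m * h) :
    gridCell h v ∈ Finset.Icc (-(m : ℤ)) m ×ˢ Finset.Icc (-(m : ℤ)) m := by
  have key : ∀ i : Fin 2, ⌊v i / h⌋ ∈ Finset.Icc (-(m : ℤ)) m := by
    intro i
    have h1 : |v i| ≤ m * h := by
      simpa using (PiLp.norm_apply_le v i).trans hv
    rw [abs_le] at h1
    rw [Finset.mem_Icc]
    constructor
    · rw [Int.le_floor, le_div_iff₀ hh]
      push_cast
      linarith
    · have : v i / h ≤ m := by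
        rw [div_le_iff₀ hh]
        exact h1.2
      exact Int.cast_le.1 (((Int.floor_le _).trans this).trans_eq (Int.cast_natCast m).symm)
  exact Finset.mem_product.2 ⟨key 0, key 1⟩

/-- With lengths x ≥ y, the far ends differ by the gap of the near ends (< y/2), the excess length
(x - y) and y times the gap of the unit directions (< y/2). The total is below x, against the
separation of the longer link. -/
theorem SparseLinks.eq_of_close {ι : Type*} {L : ι → Link} (hL : SparseLinks L) {i j : ι}
    (hij : (L j).length ≤ (L i).length) {b b' : Bool}
    (h1 : dist ((L i).pt b) ((L j).pt b') < (L j).length / 2)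
    (h2 : dist ((1 / (L i).length) • ((L i).pt (!b) - (L i).pt b))
      ((1 / (L j).length) • ((L j).pt (!b') - (L j).pt b')) < 1 / 2) : i = j := by
  by_contra hne
  have hi := hL.pos i
  have hj := hL.pos j
  have h := hL.sep i j hne b b'
  set u := (L i).pt b
  set v := (L j).pt b'
  set u' := (L i).pt !b
  set v' := (L j).pt !b'
  have hu : ‖u' - u‖ = (L i).length := by
    rw [← Link.dist_pt (L i) b, dist_comm, dist_eq_norm]
  set x := (L i).length
  set y := (L j).length
  have h3 : dist u' v' < x := by
    have e : u' - v' = (u - v) + ((1 - y / x) • (u' - u)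
        + y • ((1 / x) • (u' - u) - (1 / y) • (v' - v))) := by
      rw [smul_sub y, smul_smul, smul_smul, mul_one_div, mul_one_div, div_self hj.ne', sub_smul,
        one_smul, one_smul]
      abel
    rw [dist_eq_norm] at h1 h2 ⊢
    rw [e]
    calc _ ≤ ‖u - v‖ + (‖(1 - y / x) • (u' - u)‖
          + ‖y • ((1 / x) • (u' - u) - (1 / y) • (v' - v))‖) :=
          (norm_add_le _ _).trans (add_le_add le_rfl (norm_add_le _ _))
      _ < y / 2 + ((x - y) + y * (1 / 2)) := by
          refine add_lt_add h1 (add_lt_add_of_le_of_lt ?_ ?_)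
          · rw [norm_smul, hu, Real.norm_of_nonneg (sub_nonneg.2 ((div_le_one hi).2 hij)),
              sub_mul, div_mul_cancel₀ _ hi.ne', one_mul]
          · rw [norm_smul, Real.norm_of_nonneg hj.le]
            exact mul_lt_mul_of_pos_left h2 hj
      _ = x := by ring
  exact absurd h (not_le.2 (max_lt (by linarith) h3))

theorem SparseLinks.card_le {ι : Type*} {L : ι → Link} (hL : SparseLinks L) {l R : ℝ}
    (hl : 0 < l) (hR : 1 ≤ R) (p : Plane) (b : ι → Bool) (F : Finset ι)
    (hF : ∀ i ∈ F, l ≤ (L i).length) (hp : ∀ i ∈ F, dist ((L i).pt (b i)) p ≤ R * l) :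
    (F.card : ℝ) ≤ 10 ^ 4 * R ^ 2 := by
  classical
  let dir : ι → Plane := fun i => (1 / (L i).length) • ((L i).pt (!b i) - (L i).pt (b i))
  let g : ι → (ℤ × ℤ) × (ℤ × ℤ) := fun i =>
    (gridCell (l / 4) ((L i).pt (b i) - p), gridCell (1 / 4) (dir i))
  -- Positions use mesh l/4, so radius R·l reaches 4R cells; unit directions use mesh 1/4, giving 9²
  -- cells. Altogether there are at most (11R)²·81 ≤ 10⁴R² cells, each holding at most one link.
  set m := ⌈4 * R⌉₊ with hm
  have hm1 : 4 * R ≤ m := Nat.le_ceil _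
  have hm2 : (m : ℝ) ≤ 4 * R + 1 := (Nat.ceil_lt_add_one (by linarith)).le
  have hdir : ∀ i, ‖dir i‖ = 1 := by
    intro i
    rw [norm_smul, ← dist_eq_norm, dist_comm, Link.dist_pt, Real.norm_of_nonneg
      (one_div_pos.2 (hL.pos i)).le, one_div_mul_cancel (hL.pos i).ne']
  have hcard : F.card ≤ (((Finset.Icc (-(m : ℤ)) m) ×ˢ (Finset.Icc (-(m : ℤ)) m)) ×ˢ
      ((Finset.Icc (-((4 : ℕ) : ℤ)) (4 : ℕ)) ×ˢ (Finset.Icc (-((4 : ℕ) : ℤ)) (4 : ℕ)))).card := by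
    apply Finset.card_le_card_of_injOn g
    · intro i hi
      refine Finset.mem_coe.2 (Finset.mem_product.2 ⟨gridCell_mem (by linarith) ?_,
        gridCell_mem (by norm_num) ?_⟩)
      · rw [← dist_eq_norm]
        nlinarith [hp i hi]
      · rw [hdir]
        norm_num
    · have key : ∀ i ∈ F, ∀ j ∈ F, g i = g j → (L j).length ≤ (L i).length → i = j := by
        intro i _ j hj hij hle
        have h1 := dist_lt_of_gridCell_eq (by linarith) (congrArg Prod.fst hij)
        have h2 := dist_lt_of_gridCell_eq (by norm_num) (congrArg Prod.snd hij)
        rw [dist_sub_right] at h1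
        have := hF j hj
        exact hL.eq_of_close hle (b := b i) (b' := b j) (by linarith) (by linarith)
      intro i hi j hj hij
      rcases le_total (L j).length (L i).length with h | h
      · exact key i hi j hj hij h
      · exact (key j hj i hi hij.symm h).symm
  have hc : ∀ k : ℕ, (Finset.Icc (-(k : ℤ)) k).card = 2 * k + 1 := by
    intro k
    rw [Int.card_Icc]
    omega
  simp only [Finset.card_product, hc] at hcard
  have h1 : (F.card : ℝ) ≤ ((2 * m + 1) * (2 * m + 1)) * 81 := by
    exact_mod_cast hcard
  have h2 : (2 * m + 1 : ℝ) ≤ 11 * R := by linarith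
  have h3 : (2 * m + 1 : ℝ) * (2 * m + 1) ≤ (11 * R) * (11 * R) :=
    mul_le_mul h2 h2 (by positivity) (by positivity)
  nlinarith

/-! ### Sums over the links -/

theorem sum_le_tsum_of_fiber {ι : Type*} {F : Finset ι} {g : ι → ℝ} (κ : ι → ℕ) {a : ℕ → ℝ}
    (ha : Summable a) (ha0 : ∀ k, 0 ≤ a k)
    (h : ∀ k, ∑ i ∈ F with κ i = k, g i ≤ a k) : ∑ i ∈ F, g i ≤ ∑' k, a k := by
  classical
  rw [← Finset.sum_fiberwise_of_maps_to (t := F.image κ) (g := κ)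
    (fun i hi => Finset.mem_image_of_mem _ hi)]
  exact (Finset.sum_le_sum fun k _ => h k).trans (ha.sum_le_tsum _ fun k _ => ha0 k)

theorem sum_le_of_fiber_geometric {ι : Type*} {F : Finset ι} {g : ι → ℝ} (κ : ι → ℕ) {A q : ℝ}
    (hA : 0 ≤ A) (hq0 : 0 ≤ q) (hq : q < 1)
    (h : ∀ k, ∑ i ∈ F with κ i = k, g i ≤ A * q ^ k) : ∑ i ∈ F, g i ≤ A * (1 - q)⁻¹ := by
  rw [← tsum_geometric_of_lt_one hq0 hq, ← tsum_mul_left]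
  exact sum_le_tsum_of_fiber κ ((summable_geometric_of_lt_one hq0 hq).mul_left A)
    (fun k => mul_nonneg hA (pow_nonneg hq0 k)) h

/-- The constant of the bound on the interference of well spread links of about equal length. -/
noncomputable def spreadConst (α : ℝ) : ℝ := 4 * 10 ^ 4 * (1 - 4 / 2 ^ α)⁻¹

theorem four_div_two_rpow_lt {α : ℝ} (hα : 2 < α) : 4 / (2 : ℝ) ^ α < 1 := by
  rw [div_lt_one (by positivity)]
  calc (4 : ℝ) = 2 ^ (2 : ℝ) := by norm_num
    _ < 2 ^ α := Real.rpow_lt_rpow_of_exponent_lt (by norm_num) hα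

theorem spreadConst_pos {α : ℝ} (hα : 2 < α) : 0 < spreadConst α :=
  mul_pos (by norm_num) (inv_pos.2 (sub_pos.2 (four_div_two_rpow_lt hα)))

/-- Split into dyadic annuli around p. By packing the number of links grows like 4^k while each term
decays like 2^(-αk), leaving a geometric series of ratio 4/2^α < 1. -/
theorem SparseLinks.sum_inv_dist_le {ι : Type*} {L : ι → Link} (hL : SparseLinks L) {α : ℝ}
    (hα : 2 < α) {l D : ℝ} (hl : 0 < l) (hD : 0 < D) (p : Plane) (b : ι → Bool) (F : Finset ι)
    (hF : ∀ i ∈ F, l ≤ (L i).length) (hp : ∀ i ∈ F, D ≤ dist ((L i).pt (b i)) p) :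
    ∑ i ∈ F, (dist ((L i).pt (b i)) p ^ α)⁻¹ ≤
      spreadConst α * (max 1 (D / l) ^ 2 * (D ^ α)⁻¹) := by
  classical
  have hk : ∀ i : ι, ∃ k : ℕ, i ∈ F → 2 ^ k * D ≤ dist ((L i).pt (b i)) p ∧
      dist ((L i).pt (b i)) p ≤ 2 ^ (k + 1) * D := by
    intro i
    by_cases hi : i ∈ F
    · obtain ⟨k, h1, h2⟩ := exists_nat_pow_near ((one_le_div hD).2 (hp i hi))
        (one_lt_two (α := ℝ))
      exact ⟨k, fun _ => ⟨(le_div_iff₀ hD).1 h1, ((div_lt_iff₀ hD).1 h2).le⟩⟩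
    · exact ⟨0, fun h => absurd h hi⟩
  choose κ hκ using hk
  set M := max 1 (D / l) with hM
  have hM1 : 1 ≤ M := le_max_left _ _
  have hMD : D ≤ M * l := (div_le_iff₀ hl).1 (le_max_right _ _)
  have hDα : 0 < D ^ α := Real.rpow_pos_of_pos hD α
  have h2α : 0 < (2 : ℝ) ^ α := by positivity
  calc _ ≤ (4 * 10 ^ 4 * (M ^ 2 * (D ^ α)⁻¹)) * (1 - 4 / 2 ^ α)⁻¹ := by
        refine sum_le_of_fiber_geometric κ (by positivity) (by positivity)
          (four_div_two_rpow_lt hα) fun k => ?_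
        have hc := hL.card_le hl (R := 2 ^ (k + 1) * M)
          (by nlinarith [one_le_pow₀ (one_le_two (α := ℝ)) (n := k + 1)]) p b
          (F.filter fun i => κ i = k) (fun i hi => hF i (Finset.mem_filter.1 hi).1) (by
            intro i hi
            obtain ⟨hiF, rfl⟩ := Finset.mem_filter.1 hi
            refine (hκ i hiF).2.trans ?_
            rw [mul_assoc]
            gcongr)
        have h1 : ∀ i ∈ F.filter fun i => κ i = k,
            (dist ((L i).pt (b i)) p ^ α)⁻¹ ≤ (((2 : ℝ) ^ α) ^ k * D ^ α)⁻¹ := by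
          intro i hi
          obtain ⟨hiF, rfl⟩ := Finset.mem_filter.1 hi
          have e : ((2 : ℝ) ^ α) ^ κ i * D ^ α = (2 ^ κ i * D) ^ α := by
            rw [Real.mul_rpow (by positivity) hD.le, ← Real.rpow_natCast, ← Real.rpow_natCast,
              ← Real.rpow_mul (by norm_num), ← Real.rpow_mul (by norm_num), mul_comm α]
          rw [e]
          gcongr
          exact (hκ i hiF).1
        refine (Finset.sum_le_card_nsmul _ _ _ h1).trans ?_
        rw [nsmul_eq_mul]
        refine (mul_le_mul_of_nonneg_right hc (by positivity)).trans (le_of_eq ?_)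
        rw [div_pow, mul_inv, mul_pow, ← pow_mul, mul_comm (k + 1) 2, pow_mul, pow_succ]
        field_simp
        norm_num
        ring
    _ = _ := by
        rw [spreadConst]
        ring

/-! ### Global power control -/

/-- The power of i refers only to larger indices, so well-founded recursion from the top solves the
equations. -/
theorem exists_powers {V : Type*} [Fintype V] [LinearOrder V] (lam : V → ℝ) (a : V → V → ℝ)
    (hlam : ∀ i, 0 < lam i) (ha : ∀ j i, 0 ≤ a j i) {M B : ℝ} (hM : 0 < M) (hB : 0 ≤ B) :
    ∃ P : V → ℝ, (∀ i, 0 < P i) ∧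
      ∀ i, P i = lam i * (M + B * ∑ j with i < j, P j * a j i) := by
  have wf : WellFounded (fun i j : V => j < i) := wellFounded_gt
  let P : V → ℝ := wf.fix fun i rec =>
    lam i * (M + B * ∑ j ∈ (Finset.univ.filter fun j => i < j).attach,
      rec j.1 (Finset.mem_filter.1 j.2).2 * a j.1 i)
  have hP : ∀ i, P i = lam i * (M + B * ∑ j with i < j, P j * a j i) := by
    intro i
    simp only [P]
    rw [wf.fix_eq, ← Finset.sum_attach (Finset.univ.filter fun j => i < j)]
  refine ⟨P, fun i => ?_, hP⟩
  induction i using wf.induction with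
  | _ i ih =>
    rw [hP i]
    refine mul_pos (hlam i) (add_pos_of_pos_of_nonneg hM (mul_nonneg hB ?_))
    exact Finset.sum_nonneg fun j hj =>
      mul_nonneg (ih j (Finset.mem_filter.1 hj).2).le (ha j i)

/-- Kesselheim's power control: if every link gets little (relative) interference from and causes
little interference at the shorter ones, then powers set greedily, from the longest link to the
shortest, make all links feasible. -/
theorem exists_feasible_powers {V : Type*} [Fintype V] [LinearOrder V] (lam : V → ℝ)
    (a : V → V → ℝ) (hlam : ∀ i, 0 < lam i) (ha : ∀ j i, 0 ≤ a j i)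
    (hdiag : ∀ i, a i i = (lam i)⁻¹) {T c β N ε : ℝ} (hT : 0 < T) (hc : 0 ≤ c) (hβ : 0 < β)
    (hN : 0 ≤ N) (hε : 0 < ε)
    (htri : ∀ i j k, k < i → k < j → a j k * a k i ≤ T * (a j i * (a j k + a k i)))
    (hin : ∀ i, ∑ k with k < i, lam k * a k i ≤ c)
    (hout : ∀ i, ∑ k with k < i, lam k * a i k ≤ c)
    (hc1 : 6 * c * β * T ≤ 1 / 2) (hc2 : c * (2 + 12 * β * T + 4 * T) ≤ 1 / (3 * β)) :
    ∃ P : V → ℝ, (∀ i, 0 < P i) ∧ (∀ i, (1 + ε) * β * N * lam i ≤ P i) ∧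
      ∀ i, β * (((∑ j, P j * a j i) - P i * a i i) + N) ≤ P i * a i i := by
  have hβN : 0 ≤ β * N := mul_nonneg hβ.le hN
  -- The factor 3 reserves a third of the received signal for noise; the thirds for longer and for
  -- shorter links come from the coefficient 3β and from `hc2`. The summand 1 keeps M positive when
  -- N = 0.
  set M := 3 * ((1 + ε) * β * N) + 1 with hMdef
  have hM : 0 < M := by positivity
  obtain ⟨P, hP0, hP⟩ := exists_powers lam a hlam ha hM (B := 3 * β) (by positivity)
  have hPa : ∀ i j, 0 ≤ P j * a j i := fun i j => mul_nonneg (hP0 j).le (ha j i)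
  have hQ : ∀ i, P i * a i i = M + 3 * β * ∑ j with i < j, P j * a j i := by
    intro i
    rw [hdiag]
    conv_lhs => rw [hP i]
    field_simp [(hlam i).ne']
  refine ⟨P, hP0, fun i => ?_, fun i => ?_⟩
  · rw [hP i, mul_comm]
    refine mul_le_mul_of_nonneg_left ?_ (hlam i).le
    have : 0 ≤ 3 * β * ∑ j with i < j, P j * a j i :=
      mul_nonneg (by positivity) (Finset.sum_nonneg fun j _ => hPa i j)
    nlinarith [mul_nonneg hε.le hβN]
  · set X := ∑ k with k < i, P k * a k i with hX
    set Y := ∑ j with i < j, P j * a j i with hY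
    set Q := P i * a i i with hQdef
    have hX0 : 0 ≤ X := Finset.sum_nonneg fun j _ => hPa i j
    have hY0 : 0 ≤ Y := Finset.sum_nonneg fun j _ => hPa i j
    have hQi : Q = M + 3 * β * Y := hQ i
    have htot : ∑ j, P j * a j i = X + Q + Y := by
      have h1 : (Finset.univ : Finset V) = (Finset.univ.filter (· < i) ∪ {i}) ∪
          Finset.univ.filter (i < ·) := by
        ext j
        rcases lt_trichotomy j i with h | h | h <;> simp [h]
      rw [h1, Finset.sum_union, Finset.sum_union, Finset.sum_singleton]
      · simp
      · rw [Finset.disjoint_left]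
        intro j hj hj'
        simp only [Finset.mem_union, Finset.mem_filter, Finset.mem_univ, true_and,
          Finset.mem_singleton] at hj hj'
        rcases hj with hj | hj
        · exact lt_asymm hj hj'
        · exact hj'.ne' hj
    -- Unroll the powers of the shorter links k and swap the sums: `htri` turns a detour from j
    -- through k to i into direct interference from j at i, and `hin` and `hout` bound the remaining
    -- sums over k.
    have hXle : X ≤ c * M + 2 * c * (3 * β) * T * (X + Q + Y) := by
      calc X = ∑ k with k < i, (lam k * a k i * M
            + 3 * β * ∑ j with k < j, P j * (lam k * (a j k * a k i))) := by
            refine Finset.sum_congr rfl fun k _ => ?_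
            rw [hP k, mul_add, add_mul, Finset.mul_sum, Finset.mul_sum, Finset.mul_sum,
              Finset.sum_mul]
            congr 1
            · ring
            · exact Finset.sum_congr rfl fun j _ => by ring
        _ = (∑ k with k < i, lam k * a k i) * M
            + 3 * β * ∑ k with k < i, ∑ j with k < j, P j * (lam k * (a j k * a k i)) := by
            rw [Finset.sum_add_distrib, Finset.sum_mul, Finset.mul_sum]
        _ = (∑ k with k < i, lam k * a k i) * M
            + 3 * β * ∑ j, ∑ k with k < i ∧ k < j, P j * (lam k * (a j k * a k i)) := by
            congr 2
            refine Finset.sum_comm' fun k j => ?_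
            simp
        _ ≤ c * M + 3 * β * ∑ j, (P j * a j i) * (T * (2 * c)) := by
            refine add_le_add (mul_le_mul_of_nonneg_right (hin i) hM.le)
              (mul_le_mul_of_nonneg_left (Finset.sum_le_sum fun j _ => ?_) (by positivity))
            calc _ ≤ ∑ k with k < i ∧ k < j,
                    (P j * a j i) * (T * (lam k * a j k + lam k * a k i)) := by
                  refine Finset.sum_le_sum fun k hk => ?_
                  obtain ⟨h1, h2⟩ := (Finset.mem_filter.1 hk).2
                  have := mul_le_mul_of_nonneg_left (htri i j k h1 h2)
                    (mul_nonneg (hP0 j).le (hlam k).le)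
                  calc _ = P j * lam k * (a j k * a k i) := by ring
                    _ ≤ _ := this
                    _ = _ := by ring
              _ = (P j * a j i) * (T * (∑ k with k < i ∧ k < j, lam k * a j k
                    + ∑ k with k < i ∧ k < j, lam k * a k i)) := by
                  rw [← Finset.sum_add_distrib, Finset.mul_sum, Finset.mul_sum]
              _ ≤ _ := by
                  refine mul_le_mul_of_nonneg_left (mul_le_mul_of_nonneg_left ?_ hT.le)
                    (hPa i j)
                  rw [two_mul]
                  refine add_le_add ((Finset.sum_le_sum_of_subset_of_nonneg ?_ ?_).trans (hout j))
                    ((Finset.sum_le_sum_of_subset_of_nonneg ?_ ?_).trans (hin i))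
                  · intro k hk
                    simp only [Finset.mem_filter, Finset.mem_univ, true_and] at hk ⊢
                    exact hk.2
                  · exact fun k _ _ => mul_nonneg (hlam k).le (ha j k)
                  · intro k hk
                    simp only [Finset.mem_filter, Finset.mem_univ, true_and] at hk ⊢
                    exact hk.1
                  · exact fun k _ _ => mul_nonneg (hlam k).le (ha k i)
        _ = _ := by
            rw [← Finset.sum_mul, htot]
            ring
    have hMQ : M ≤ Q := by
      rw [hQi]
      have : 0 ≤ 3 * β * Y := by positivity
      linarith
    have hQ0 : 0 < Q := hM.trans_le hMQ
    have hYQ : 3 * β * Y ≤ Q := by linarith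
    have hNQ : 3 * (β * N) ≤ Q := by
      have := mul_nonneg hε.le hβN
      nlinarith
    -- X also occurs on the right of `hXle`; by `hc1` its coefficient there is at most 1/2, so it
    -- can be absorbed.
    have hXQ : X ≤ c * (2 + 12 * β * T + 4 * T) * Q := by
      have h1 : 2 * c * (3 * β) * T * X ≤ 1 / 2 * X := by nlinarith
      have h2 : c * M ≤ c * Q := mul_le_mul_of_nonneg_left hMQ hc
      have h3 : 2 * c * T * (3 * β * Y) ≤ 2 * c * T * Q :=
        mul_le_mul_of_nonneg_left hYQ (by positivity)
      nlinarith
    have hXβ : 3 * β * X ≤ Q := by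
      have h1 : X ≤ 1 / (3 * β) * Q := hXQ.trans (mul_le_mul_of_nonneg_right hc2 hQ0.le)
      rw [one_div, ← div_eq_inv_mul, le_div_iff₀ (by positivity)] at h1
      linarith
    rw [htot]
    nlinarith

/-! ### Independent sets of links -/

/-- The links of `S` are pairwise far apart: any two ends of two links are at distance more than
`l f (l' / l)`, where `l ≤ l'` are the lengths of the links. -/
def IndepLinks {ι : Type*} (f : ℝ → ℝ) (L : ι → Link) (S : Finset ι) : Prop :=
  ∀ i ∈ S, ∀ j ∈ S, i ≠ j → (L i).length ≤ (L j).length → ∀ b b',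
    (L i).length * f ((L j).length / (L i).length) < dist ((L i).pt b) ((L j).pt b')

/-- Class t collects the links 2^t to 2^(t+1) times shorter than i. Their lengths lie between l and
2l for l = l_i/2^(t+1), and their distances from i are at least l·f(2^t), so the annulus bound
applies to each class. The weight W accommodates both power schemes. -/
theorem SparseLinks.sum_short_le {ι : Type*} {L : ι → Link} (hL : SparseLinks L) {α : ℝ}
    (hα : 2 < α) {f W : ℝ → ℝ} (hf : MonotoneOn f (Set.Ici 1)) (hf1 : ∀ x, 1 ≤ x → 1 ≤ f x)
    (hW : MonotoneOn W (Set.Ici 1)) (hW0 : ∀ x, 1 ≤ x → 0 ≤ W x)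
    (hs : Summable fun t : ℕ => W (2 ^ (t + 1)) * (f (2 ^ t) ^ 2 * (f (2 ^ t) ^ α)⁻¹))
    {S : Finset ι} (hS : IndepLinks f L S) {i : ι} (hi : i ∈ S) (b' : Bool) (b : ι → Bool)
    (F : Finset ι) (hF : ∀ k ∈ F, k ∈ S ∧ k ≠ i ∧ (L k).length ≤ (L i).length) :
    ∑ k ∈ F, W ((L i).length / (L k).length) *
        ((L k).length ^ α * (dist ((L k).pt (b k)) ((L i).pt b') ^ α)⁻¹) ≤
      2 ^ α * spreadConst α *
        ∑' t : ℕ, W (2 ^ (t + 1)) * (f (2 ^ t) ^ 2 * (f (2 ^ t) ^ α)⁻¹) := by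
  classical
  have hC := spreadConst_pos hα
  have h2 : ∀ t : ℕ, (1 : ℝ) ≤ 2 ^ t := fun t => one_le_pow₀ one_le_two
  have hli := hL.pos i
  have hk : ∀ k : ι, ∃ t : ℕ, k ∈ F → 2 ^ t ≤ (L i).length / (L k).length ∧
      (L i).length / (L k).length < 2 ^ (t + 1) := by
    intro k
    by_cases hkF : k ∈ F
    · obtain ⟨t, ht⟩ := exists_nat_pow_near ((one_le_div (hL.pos k)).2 (hF k hkF).2.2)
        (one_lt_two (α := ℝ))
      exact ⟨t, fun _ => ht⟩
    · exact ⟨0, fun h => absurd h hkF⟩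
  choose κ hκ using hk
  rw [← tsum_mul_left]
  refine sum_le_tsum_of_fiber κ (hs.mul_left _) (fun t => ?_) fun t => ?_
  · have := hf1 _ (h2 t)
    have := hW0 _ (h2 (t + 1))
    positivity
  set d := f (2 ^ t) with hd
  have hd1 : 1 ≤ d := hf1 _ (h2 t)
  have hd0 : 0 < d := by linarith
  set w := W (2 ^ (t + 1)) with hw
  have hw0 : 0 ≤ w := hW0 _ (h2 (t + 1))
  set l := (L i).length / 2 ^ (t + 1) with hl
  have hl0 : 0 < l := by positivity
  have hlen : ∀ k ∈ F.filter fun k => κ k = t, l ≤ (L k).length ∧ (L k).length ≤ 2 * l := by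
    intro k hk
    obtain ⟨hkF, rfl⟩ := Finset.mem_filter.1 hk
    obtain ⟨h1, h3⟩ := hκ k hkF
    rw [le_div_iff₀ (hL.pos k)] at h1
    rw [div_lt_iff₀ (hL.pos k)] at h3
    constructor
    · rw [hl, div_le_iff₀ (by positivity)]
      linarith
    · rw [hl, pow_succ, ← mul_div_assoc, le_div_iff₀ (by positivity)]
      linarith
  have hsum := hL.sum_inv_dist_le hα hl0 (mul_pos hl0 hd0) ((L i).pt b') b
    (F.filter fun k => κ k = t) (fun k hk => (hlen k hk).1) (by
      intro k hk
      have hlk := (hlen k hk).1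
      obtain ⟨hkF, rfl⟩ := Finset.mem_filter.1 hk
      obtain ⟨hkS, hne, hle⟩ := hF k hkF
      refine le_trans ?_ (hS k hkS i hi hne hle (b k) b').le
      have : d ≤ f ((L i).length / (L k).length) :=
        hf (h2 _) ((h2 (κ k)).trans (hκ k hkF).1) (hκ k hkF).1
      exact mul_le_mul hlk this hd0.le (hL.pos k).le)
  rw [mul_div_cancel_left₀ _ hl0.ne', max_eq_right hd1, Real.mul_rpow hl0.le hd0.le] at hsum
  have hlα : 0 < l ^ α := Real.rpow_pos_of_pos hl0 α
  calc _ ≤ ∑ k ∈ F with κ k = t,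
          (w * (2 * l) ^ α) * (dist ((L k).pt (b k)) ((L i).pt b') ^ α)⁻¹ := by
        refine Finset.sum_le_sum fun k hk => ?_
        obtain ⟨hkF, hkt⟩ := Finset.mem_filter.1 hk
        rw [mul_assoc]
        have h1 : W ((L i).length / (L k).length) ≤ w := by
          have := hκ k hkF
          rw [hkt] at this
          exact hW ((h2 t).trans this.1) (h2 _) this.2.le
        have h3 : (L k).length ^ α ≤ (2 * l) ^ α :=
          Real.rpow_le_rpow (hL.pos k).le (hlen k hk).2 (by linarith)
        have h4 := (hL.pos k).le
        gcongr
    _ ≤ (w * (2 * l) ^ α) * (spreadConst α * (d ^ 2 * (l ^ α * d ^ α)⁻¹)) := by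
        rw [← Finset.mul_sum]
        gcongr
    _ = _ := by
        rw [Real.mul_rpow zero_le_two hl0.le]
        field_simp

/-- In the class of links about 2^t times longer than i, the distance is at least D = l_i·f(2^t) and
the length at least l = l_i·2^t. As f(x) ≤ γx, D/l ≤ γ, whence the factor γ². Only the oblivious
scheme needs this bound: greedy powers account for longer links by construction. -/
theorem SparseLinks.sum_long_le {ι : Type*} {L : ι → Link} (hL : SparseLinks L) {α : ℝ}
    (hα : 2 < α) {f : ℝ → ℝ} (hf : MonotoneOn f (Set.Ici 1)) {γ σ : ℝ} (hγ : 1 ≤ γ) (hσ : 0 ≤ σ)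
    (hf1 : ∀ x, 1 ≤ x → 1 ≤ f x) (hfγ : ∀ x, 1 ≤ x → f x ≤ γ * x)
    (hs : Summable fun t : ℕ => ((2 : ℝ) ^ (t + 1)) ^ σ * (γ ^ 2 * (f (2 ^ t) ^ α)⁻¹))
    {S : Finset ι} (hS : IndepLinks f L S) {i : ι} (hi : i ∈ S) (b' : Bool) (b : ι → Bool)
    (F : Finset ι) (hF : ∀ k ∈ F, k ∈ S ∧ i ≠ k ∧ (L i).length ≤ (L k).length) :
    ∑ k ∈ F, (L k).length ^ σ * (dist ((L k).pt (b k)) ((L i).pt b') ^ α)⁻¹ ≤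
      spreadConst α * ((L i).length ^ σ * ((L i).length ^ α)⁻¹) *
        ∑' t : ℕ, ((2 : ℝ) ^ (t + 1)) ^ σ * (γ ^ 2 * (f (2 ^ t) ^ α)⁻¹) := by
  classical
  have hC := spreadConst_pos hα
  have h2 : ∀ t : ℕ, (1 : ℝ) ≤ 2 ^ t := fun t => one_le_pow₀ one_le_two
  have hli := hL.pos i
  have hk : ∀ k : ι, ∃ t : ℕ, k ∈ F → 2 ^ t ≤ (L k).length / (L i).length ∧
      (L k).length / (L i).length < 2 ^ (t + 1) := by
    intro k
    by_cases hkF : k ∈ F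
    · obtain ⟨t, ht⟩ := exists_nat_pow_near ((one_le_div hli).2 (hF k hkF).2.2)
        (one_lt_two (α := ℝ))
      exact ⟨t, fun _ => ht⟩
    · exact ⟨0, fun h => absurd h hkF⟩
  choose κ hκ using hk
  rw [← tsum_mul_left]
  refine sum_le_tsum_of_fiber κ (hs.mul_left _) (fun t => ?_) fun t => ?_
  · have := hf1 _ (h2 t)
    positivity
  set d := f (2 ^ t) with hd
  have hd1 : 1 ≤ d := hf1 _ (h2 t)
  have hd0 : 0 < d := by linarith
  set l := (L i).length * 2 ^ t with hl
  have hl0 : 0 < l := by positivity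
  have hsum := hL.sum_inv_dist_le hα hl0 (mul_pos hli hd0) ((L i).pt b') b
    (F.filter fun k => κ k = t) (by
      intro k hk
      obtain ⟨hkF, rfl⟩ := Finset.mem_filter.1 hk
      have := (le_div_iff₀ hli).1 (hκ k hkF).1
      rw [hl]
      linarith) (by
      intro k hk
      obtain ⟨hkF, rfl⟩ := Finset.mem_filter.1 hk
      obtain ⟨hkS, hne, hle⟩ := hF k hkF
      rw [dist_comm]
      refine le_trans ?_ (hS i hi k hkS hne hle b' (b k)).le
      have : d ≤ f ((L k).length / (L i).length) :=
        hf (h2 _) ((h2 (κ k)).trans (hκ k hkF).1) (hκ k hkF).1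
      exact mul_le_mul_of_nonneg_left this hli.le)
  have hmax : max 1 ((L i).length * d / l) ≤ γ := by
    refine max_le hγ ?_
    rw [hl, mul_div_mul_left _ _ hli.ne', div_le_iff₀ (by positivity)]
    exact hfγ _ (h2 t)
  have hdα : 0 < d ^ α := Real.rpow_pos_of_pos hd0 α
  have hliα : 0 < (L i).length ^ α := Real.rpow_pos_of_pos hli α
  calc _ ≤ ∑ k ∈ F with κ k = t,
          ((L i).length * 2 ^ (t + 1)) ^ σ * (dist ((L k).pt (b k)) ((L i).pt b') ^ α)⁻¹ := by
        refine Finset.sum_le_sum fun k hk => ?_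
        obtain ⟨hkF, hkt⟩ := Finset.mem_filter.1 hk
        have h1 : (L k).length ≤ (L i).length * 2 ^ (t + 1) := by
          have := (div_lt_iff₀ hli).1 (hκ k hkF).2
          rw [hkt] at this
          linarith
        have h4 := (hL.pos k).le
        gcongr
    _ ≤ ((L i).length * 2 ^ (t + 1)) ^ σ *
          (spreadConst α * (γ ^ 2 * (((L i).length * d) ^ α)⁻¹)) := by
        rw [← Finset.mul_sum]
        refine mul_le_mul_of_nonneg_left (hsum.trans ?_) (by positivity)
        gcongr
    _ = _ := by
        rw [Real.mul_rpow hli.le (by positivity), Real.mul_rpow hli.le hd0.le, mul_inv]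
        ring

/-! ### Feasibility of independent sets -/

theorem feasible_of_indepLinks {ι : Type*} [Finite ι] {L : ι → Link} (hL : SparseLinks L)
    {α β N ε c : ℝ} (hα : 2 < α) (hβ : 0 < β) (hN : 0 ≤ N) (hε : 0 < ε) (hc : 0 ≤ c)
    (hc1 : 6 * c * β * 3 ^ α ≤ 1 / 2) (hc2 : c * (2 + 12 * β * 3 ^ α + 4 * 3 ^ α) ≤ 1 / (3 * β))
    {f : ℝ → ℝ} (hf1 : ∀ x, 1 ≤ x → 1 ≤ f x) {S : Finset ι} (hS : IndepLinks f L S)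
    (hsum : ∀ i ∈ S, ∀ b' b : Bool, ∀ F : Finset ι,
      (∀ k ∈ F, k ∈ S ∧ k ≠ i ∧ (L k).length ≤ (L i).length) →
      ∑ k ∈ F, (L k).length ^ α * (dist ((L k).pt b) ((L i).pt b') ^ α)⁻¹ ≤ c) :
    Feasible α β N ε L S := by
  classical
  have hα0 : 0 < α := by linarith
  obtain ⟨m, ⟨e⟩⟩ := Finite.exists_equiv_fin ι
  -- Order by length, with ties broken by an arbitrary numbering, since the greedy powers need a
  -- linear order.
  let key : S → ℝ ×ₗ Fin m := fun i => toLex ((L i).length, e i)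
  have hkey : Function.Injective key := by
    intro i j hij
    have := congrArg (fun z => (ofLex z).2) hij
    exact Subtype.ext (e.injective this)
  let _ : LinearOrder S := LinearOrder.lift' key hkey
  have hlt : ∀ i j : S, i < j → (L i).length ≤ (L j).length := by
    intro i j hij
    have : key i ≤ key j := le_of_lt hij
    exact Prod.Lex.monotone_fst _ _ this
  let D : S → S → ℝ := fun j i => dist (L j).sender (L i).receiver
  have hlpos : ∀ i : S, 0 < (L i).length := fun i => hL.pos i
  have hfar : ∀ k i : S, k < i → ∀ b b', (L k).length < dist ((L k).pt b) ((L i).pt b') := by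
    intro k i hki b b'
    have hne : (k : ι) ≠ i := fun h => hki.ne (Subtype.ext h)
    have hle := hlt k i hki
    refine lt_of_le_of_lt ?_ (hS k k.2 i i.2 hne hle b b')
    exact le_mul_of_one_le_right (hlpos k).le (hf1 _ ((one_le_div (hlpos k)).2 hle))
  have hDki : ∀ k i : S, k < i → (L k).length < D k i := fun k i h => hfar k i h true false
  have hDik : ∀ k i : S, k < i → (L k).length < D i k := fun k i h => by
    have := hfar k i h false true
    rwa [dist_comm] at this
  have hDpos : ∀ j i : S, 0 < D j i := by
    intro j i
    rcases lt_trichotomy j i with h | rfl | h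
    · exact (hlpos j).trans (hDki j i h)
    · exact hlpos j
    · exact (hlpos i).trans (hDik i j h)
  obtain ⟨P, hP0, hPN, hP⟩ := exists_feasible_powers (V := S) (fun i => (L i).length ^ α)
    (fun j i => (D j i ^ α)⁻¹) (fun i => Real.rpow_pos_of_pos (hlpos i) α)
    (fun j i => inv_nonneg.2 (Real.rpow_nonneg dist_nonneg α)) (fun i => rfl)
    (T := 3 ^ α) (c := c) (β := β) (N := N) (ε := ε) (by positivity) hc hβ hN hε
    (by
      intro i j k hki hkj
      have h1 := hDki k i hki
      have h2 := hDik k j hkj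
      have h0 := hDpos j i
      -- Independence with f ≥ 1 makes the shorter link k shorter than both distances, so passing
      -- through it costs at most a third equal term. This is the source of T = 3^α.
      have htri : D j i ≤ 3 * max (D j k) (D k i) := by
        have t1 : D j i ≤ D j k + (L k).length + D k i := by
          have := dist_triangle4 (L j).sender (L k).receiver (L k).sender (L i).receiver
          rwa [dist_comm (L k).receiver] at this
        have := le_max_left (D j k) (D k i)
        have := le_max_right (D j k) (D k i)
        linarith
      have hx := Real.rpow_pos_of_pos (hDpos j k) α
      have hy := Real.rpow_pos_of_pos (hDpos k i) α
      have hz := Real.rpow_pos_of_pos h0 α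
      have key : D j i ^ α ≤ 3 ^ α * (D j k ^ α + D k i ^ α) := by
        refine (Real.rpow_le_rpow h0.le htri hα0.le).trans ?_
        rw [Real.mul_rpow (by norm_num) (le_max_of_le_left (hDpos j k).le)]
        refine mul_le_mul_of_nonneg_left ?_ (by positivity)
        rcases max_choice (D j k) (D k i) with h | h <;> rw [h] <;> linarith
      have e : (D j i ^ α)⁻¹ * ((D j k ^ α)⁻¹ + (D k i ^ α)⁻¹)
          = (D j k ^ α + D k i ^ α) * ((D j k ^ α)⁻¹ * (D k i ^ α)⁻¹ * (D j i ^ α)⁻¹) := by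
        field_simp
        ring
      calc (D j k ^ α)⁻¹ * (D k i ^ α)⁻¹
          = D j i ^ α * ((D j k ^ α)⁻¹ * (D k i ^ α)⁻¹ * (D j i ^ α)⁻¹) := by
            field_simp
        _ ≤ (3 ^ α * (D j k ^ α + D k i ^ α)) *
              ((D j k ^ α)⁻¹ * (D k i ^ α)⁻¹ * (D j i ^ α)⁻¹) :=
            mul_le_mul_of_nonneg_right key (by positivity)
        _ = _ := by rw [e]; ring)
    (by
      intro i
      have := hsum i i.2 false true
        ((Finset.univ.filter fun k : S => k < i).map (Function.Embedding.subtype _)) (by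
          intro k hk
          obtain ⟨k, hk', rfl⟩ := Finset.mem_map.1 hk
          have hki := (Finset.mem_filter.1 hk').2
          exact ⟨k.2, fun h => hki.ne (Subtype.ext h), hlt k i hki⟩)
      rw [Finset.sum_map] at this
      exact this)
    (by
      intro i
      have := hsum i i.2 true false
        ((Finset.univ.filter fun k : S => k < i).map (Function.Embedding.subtype _)) (by
          intro k hk
          obtain ⟨k, hk', rfl⟩ := Finset.mem_map.1 hk
          have hki := (Finset.mem_filter.1 hk').2
          exact ⟨k.2, fun h => hki.ne (Subtype.ext h), hlt k i hki⟩)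
      rw [Finset.sum_map] at this
      refine (Finset.sum_congr rfl fun k _ => ?_).trans_le this
      simp only [D]
      rw [dist_comm]
      rfl)
    hc1 hc2
  let P' : ι → ℝ := fun i => if h : i ∈ S then P ⟨i, h⟩ else 1
  have hP' : ∀ i : S, P' i = P i := fun i => by simp [P']
  refine ⟨P', fun i => ?_, fun i hi => ?_, fun i hi => ⟨fun j hj hji => ?_, ?_⟩⟩
  · by_cases h : i ∈ S
    · simp [P', h, hP0]
    · simp [P', h]
  · have := hPN ⟨i, hi⟩
    rwa [← hP'] at this
  · exact dist_pos.1 (hDpos ⟨j, hj⟩ ⟨i, hi⟩)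
  · have := hP ⟨i, hi⟩
    have e1 : ∑ j : S, P j * (D j ⟨i, hi⟩ ^ α)⁻¹
        = ∑ j ∈ S, P' j / dist (L j).sender (L i).receiver ^ α := by
      rw [← Finset.sum_coe_sort S]
      exact Finset.sum_congr rfl fun j _ => by rw [hP', div_eq_mul_inv]
    rw [e1, ← hP', ← Finset.add_sum_erase _ _ hi] at this
    have e2 : P' i * (D ⟨i, hi⟩ ⟨i, hi⟩ ^ α)⁻¹ = P' i / (L i).length ^ α := rfl
    have e3 : P' i / dist (L i).sender (L i).receiver ^ α = P' i / (L i).length ^ α := rfl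
    rw [e2, e3, add_sub_cancel_left] at this
    convert this

/-- Being interference limited leaves at most 1/(1+ε) of the signal budget to noise; `hη` fits the
interference into the remaining ε/(1+ε). -/
theorem feasibleWith_oblivious {ι : Type*} {L : ι → Link} (hL : SparseLinks L)
    {α β N ε τ C η : ℝ} (hβ : 0 < β) (hε : 0 < ε) (hC : 0 < C) {f : ℝ → ℝ}
    (hf1 : ∀ x, 1 ≤ x → 1 ≤ f x) {S : Finset ι} (hS : IndepLinks f L S)
    (hη : β * η ≤ ε / (1 + ε))
    (hlim : InterferenceLimited α β N ε L (obliviousPower α τ C L) S)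
    (hsum : ∀ i ∈ S, ∀ F : Finset ι, (∀ k ∈ F, k ∈ S ∧ k ≠ i) →
      ∑ k ∈ F, (L k).length ^ (τ * α) * (dist (L k).sender (L i).receiver ^ α)⁻¹ ≤
        η * ((L i).length ^ (τ * α) * ((L i).length ^ α)⁻¹)) :
    FeasibleWith α β N L (obliviousPower α τ C L) S := by
  classical
  intro i hi
  refine ⟨fun j hj hji => ?_, ?_⟩
  · rw [← dist_pos]
    rcases le_total (L j).length (L i).length with h | h
    · refine lt_of_le_of_lt ?_ (hS j hj i hi hji h true false)
      have := hf1 _ ((one_le_div (hL.pos j)).2 h)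
      exact mul_nonneg (hL.pos j).le (by linarith)
    · rw [dist_comm]
      refine lt_of_le_of_lt ?_ (hS i hi j hj hji.symm h false true)
      have := hf1 _ ((one_le_div (hL.pos i)).2 h)
      exact mul_nonneg (hL.pos i).le (by linarith)
  · have hsum' : ∑ k ∈ S.erase i, (L k).length ^ (τ * α) *
        (dist (L k).sender (L i).receiver ^ α)⁻¹ ≤
          η * ((L i).length ^ (τ * α) * ((L i).length ^ α)⁻¹) :=
      hsum i hi _ fun k hk => ⟨Finset.mem_of_mem_erase hk, Finset.ne_of_mem_erase hk⟩
    have hlα : 0 < (L i).length ^ α := Real.rpow_pos_of_pos (hL.pos i) α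
    set G := C * ((L i).length ^ (τ * α) * ((L i).length ^ α)⁻¹) with hG
    have hG0 : 0 ≤ G := by
      have := (hL.pos i).le
      positivity
    have h1 : ∑ j ∈ S.erase i, obliviousPower α τ C L j / dist (L j).sender (L i).receiver ^ α
        ≤ η * G := by
      calc _ = C * ∑ k ∈ S.erase i, (L k).length ^ (τ * α) *
            (dist (L k).sender (L i).receiver ^ α)⁻¹ := by
            rw [Finset.mul_sum]
            refine Finset.sum_congr rfl fun k _ => ?_
            rw [obliviousPower, div_eq_mul_inv, mul_assoc]
        _ ≤ C * (η * ((L i).length ^ (τ * α) * ((L i).length ^ α)⁻¹)) :=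
            mul_le_mul_of_nonneg_left hsum' hC.le
        _ = η * G := by ring
    have h2 : obliviousPower α τ C L i / (L i).length ^ α = G := by
      rw [obliviousPower, div_eq_mul_inv, mul_assoc]
    have h3 : (1 + ε) * (β * N) ≤ G := by
      have := hlim i hi
      rw [← h2, le_div_iff₀ hlα]
      linarith
    have h4 : β * (η * G) ≤ ε / (1 + ε) * G := by
      rw [← mul_assoc]
      exact mul_le_mul_of_nonneg_right hη hG0
    have h5 : β * N ≤ 1 / (1 + ε) * G := by
      rw [one_div, ← div_eq_inv_mul, le_div_iff₀ (by linarith)]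
      linarith
    have h6 : ε / (1 + ε) * G + 1 / (1 + ε) * G = G := by
      field_simp
      ring
    rw [h2]
    calc _ ≤ β * (η * G + N) := by
          refine mul_le_mul_of_nonneg_left (add_le_add ?_ le_rfl) hβ.le
          convert h1
      _ ≤ G := by linarith

theorem exists_mul_rpow_le {α : ℝ} (hα : 2 < α) (A : ℝ) {η : ℝ} (hη : 0 < η) :
    ∃ γ : ℝ, 1 ≤ γ ∧ A * (γ ^ 2 * (γ ^ α)⁻¹) ≤ η := by
  have h1 : Filter.Tendsto (fun γ : ℝ => A * γ ^ (-(α - 2))) Filter.atTop (nhds (A * 0)) :=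
    (tendsto_rpow_neg_atTop (by linarith)).const_mul A
  rw [mul_zero] at h1
  obtain ⟨γ, h2, h3⟩ := ((h1.eventually (gt_mem_nhds hη)).and
    (Filter.eventually_ge_atTop 1)).exists
  refine ⟨γ, h3, ?_⟩
  have h4 : 0 < γ := by linarith
  rw [neg_sub, Real.rpow_sub h4, Real.rpow_two, div_eq_mul_inv] at h2
  exact h2.le

/-- The function whose independent sets are feasible with global power control. -/
noncomputable def logSpread (γ p : ℝ) (x : ℝ) : ℝ := γ * (1 + Real.logb 2 x) ^ p

theorem one_le_logSpread {γ p : ℝ} (hγ : 1 ≤ γ) (hp : 0 ≤ p) {x : ℝ} (hx : 1 ≤ x) :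
    1 ≤ logSpread γ p x := by
  have h1 : 0 ≤ Real.logb 2 x := Real.logb_nonneg one_lt_two hx
  have h2 : 1 ≤ (1 + Real.logb 2 x) ^ p := Real.one_le_rpow (by linarith) hp
  exact one_le_mul_of_one_le_of_one_le hγ h2

theorem monotoneOn_logSpread {γ p : ℝ} (hγ : 1 ≤ γ) (hp : 0 ≤ p) :
    MonotoneOn (logSpread γ p) (Set.Ici 1) := by
  intro x hx y hy hxy
  have hx1 : (1 : ℝ) ≤ x := hx
  have h1 : 0 ≤ Real.logb 2 x := Real.logb_nonneg one_lt_two hx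
  have h2 : Real.logb 2 x ≤ Real.logb 2 y :=
    Real.logb_le_logb_of_le one_lt_two (by linarith) hxy
  unfold logSpread
  gcongr

theorem logSpread_two_pow (γ p : ℝ) (t : ℕ) : logSpread γ p (2 ^ t) = γ * (1 + t) ^ p := by
  rw [logSpread, Real.logb_pow, Real.logb_self_eq_one one_lt_two, mul_one]

/-- The exponent p = 2/(α-2) is chosen so that f(2^t)^(2-α) = γ^(2-α)(1+t)^(-2), which is summable;
a large γ then makes the sum as small as Kesselheim's criterion demands. -/
theorem exists_global_feasible {α β ε : ℝ} (hα : 2 < α) (hβ : 0 < β) (hε : 0 < ε) :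
    ∃ γ : ℝ, 1 ≤ γ ∧ ∀ (ι : Type) [Finite ι] (L : ι → Link), SparseLinks L → ∀ N : ℝ, 0 ≤ N →
      ∀ S : Finset ι, IndepLinks (logSpread γ (2 / (α - 2))) L S → Feasible α β N ε L S := by
  have hp : 0 ≤ 2 / (α - 2) := div_nonneg zero_le_two (by linarith)
  obtain ⟨c, hc, hc1, hc2⟩ : ∃ c : ℝ, 0 < c ∧ 6 * c * β * 3 ^ α ≤ 1 / 2 ∧
      c * (2 + 12 * β * 3 ^ α + 4 * 3 ^ α) ≤ 1 / (3 * β) := by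
    have h3 : (0 : ℝ) < 3 ^ α := by positivity
    refine ⟨min (1 / (12 * β * 3 ^ α)) (1 / (3 * β) / (2 + 12 * β * 3 ^ α + 4 * 3 ^ α)),
      by positivity, ?_, ?_⟩
    · have := (le_div_iff₀ (by positivity)).1 (min_le_left (1 / (12 * β * 3 ^ α))
        (1 / (3 * β) / (2 + 12 * β * 3 ^ α + 4 * 3 ^ α)))
      linarith
    · exact (le_div_iff₀ (by positivity)).1 (min_le_right _ _)
  obtain ⟨γ, hγ, hγc⟩ := exists_mul_rpow_le hα
    (2 ^ α * spreadConst α * ∑' t : ℕ, (((1 + t : ℝ)) ^ 2)⁻¹) hc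
  refine ⟨γ, hγ, fun ι _ L hL N hN S hS => ?_⟩
  have hγ0 : 0 < γ := by linarith
  have hterm : ∀ t : ℕ, (1 : ℝ) * (logSpread γ (2 / (α - 2)) (2 ^ t) ^ 2 *
      (logSpread γ (2 / (α - 2)) (2 ^ t) ^ α)⁻¹) = (γ ^ 2 * (γ ^ α)⁻¹) * ((1 + t : ℝ) ^ 2)⁻¹ := by
    intro t
    have ht : (0 : ℝ) < 1 + t := by positivity
    rw [logSpread_two_pow, Real.mul_rpow hγ0.le (by positivity), mul_pow, mul_inv, one_mul,
      ← Real.rpow_mul ht.le, ← Real.rpow_natCast _ 2, ← Real.rpow_natCast ((1 + t : ℝ) ^ _) 2,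
      ← Real.rpow_mul ht.le, ← Real.rpow_neg ht.le, ← Real.rpow_natCast (1 + t : ℝ) 2,
      ← Real.rpow_neg ht.le, mul_mul_mul_comm, ← Real.rpow_add ht]
    congr 2
    have : α - 2 ≠ 0 := by linarith
    field_simp
    push_cast
    ring
  have hsummable : Summable fun t : ℕ => ((1 + t : ℝ) ^ 2)⁻¹ := by
    have := (summable_nat_add_iff 1).2 (Real.summable_nat_pow_inv.2 (one_lt_two))
    refine this.congr fun t => ?_
    push_cast
    rw [add_comm]
  refine feasible_of_indepLinks hL hα hβ hN hε hc.le hc1 hc2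
    (fun x hx => one_le_logSpread hγ hp hx) hS fun i hi b' b F hF => ?_
  have := hL.sum_short_le hα (monotoneOn_logSpread hγ hp) (fun x hx => one_le_logSpread hγ hp hx)
    (W := fun _ => 1) (fun _ _ _ _ _ => le_rfl) (fun _ _ => zero_le_one)
    ((hsummable.mul_left _).congr fun t => (hterm t).symm) hS hi b' (fun _ => b) F hF
  simp only [hterm, tsum_mul_left] at this
  simp only [one_mul] at this
  refine this.trans (le_of_eq_of_le ?_ hγc)
  ring

/-- The function whose independent sets are feasible with oblivious power. -/
noncomputable def powSpread (γ δ : ℝ) (x : ℝ) : ℝ := γ * x ^ δ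

theorem exists_oblivious_feasible {α β ε : ℝ} (hα : 2 < α) (hβ : 0 < β) (hε : 0 < ε) :
    ∃ τ : ℝ, 0 < τ ∧ τ < 1 ∧ ∃ δ : ℝ, 0 < δ ∧ δ < 1 ∧ ∃ γ : ℝ, 1 ≤ γ ∧
      ∀ (ι : Type) (L : ι → Link), SparseLinks L → ∀ N C : ℝ, 0 < C →
      ∀ S : Finset ι, IndepLinks (powSpread γ δ) L S →
        InterferenceLimited α β N ε L (obliviousPower α τ C L) S →
        FeasibleWith α β N L (obliviousPower α τ C L) S := by
  -- With τ = 1 - 2s and δ = 1 - s, the dyadic exponents become -s(α + 2) for shorter links and -sα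
  -- for longer ones. Both series are therefore geometric.
  set s := (α - 2) / (4 * α) with hs
  have hα0 : 0 < α := by linarith
  have hs0 : 0 < s := div_pos (by linarith) (by linarith)
  have hsα : s * (4 * α) = α - 2 := div_mul_cancel₀ _ (by positivity)
  have hs4 : s < 1 / 4 := by
    rw [hs, div_lt_iff₀ (by positivity)]
    linarith
  set τ := 1 - 2 * s with hτ
  set δ := 1 - s with hδ
  have hτ0 : 0 < τ := by linarith
  have hδ0 : 0 < δ := by linarith
  set σ := τ * α with hσ
  set ω := (1 - τ) * α with hω
  have hσ0 : 0 ≤ σ := by positivity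
  have hω0 : 0 ≤ ω := mul_nonneg (by linarith) hα0.le
  have hexp1 : ω + δ * 2 - δ * α < 0 := by
    have : ω + δ * 2 - δ * α = s * (3 * α) - s * 2 - (α - 2) := by
      rw [hω, hτ, hδ]
      ring
    nlinarith
  have hexp2 : σ - δ * α < 0 := by
    have : σ - δ * α = - (s * α) := by
      rw [hσ, hτ, hδ]
      ring
    have := mul_pos hs0 hα0
    linarith
  set q1 := (2 : ℝ) ^ (ω + δ * 2 - δ * α) with hq1
  set q2 := (2 : ℝ) ^ (σ - δ * α) with hq2
  have hq1' : q1 < 1 := Real.rpow_lt_one_of_one_lt_of_neg one_lt_two hexp1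
  have hq2' : q2 < 1 := Real.rpow_lt_one_of_one_lt_of_neg one_lt_two hexp2
  have hq10 : 0 ≤ q1 := by positivity
  have hq20 : 0 ≤ q2 := by positivity
  have hη : 0 < ε / (1 + ε) / β := by positivity
  obtain ⟨γ, hγ, hγη⟩ := exists_mul_rpow_le hα
    (2 ^ α * spreadConst α * (2 ^ ω * (1 - q1)⁻¹) + spreadConst α * (2 ^ σ * (1 - q2)⁻¹)) hη
  have hγ0 : 0 < γ := by linarith
  refine ⟨τ, hτ0, by linarith, δ, hδ0, by linarith, γ, hγ, fun ι L hL N C hC S hS hlim => ?_⟩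
  have hf1 : ∀ x, 1 ≤ x → 1 ≤ powSpread γ δ x := fun x hx =>
    one_le_mul_of_one_le_of_one_le hγ (Real.one_le_rpow hx hδ0.le)
  have hf : MonotoneOn (powSpread γ δ) (Set.Ici 1) := by
    intro x hx y hy hxy
    have hx1 : (1 : ℝ) ≤ x := hx
    unfold powSpread
    gcongr
  have hfγ : ∀ x, 1 ≤ x → powSpread γ δ x ≤ γ * x := fun x hx => by
    refine mul_le_mul_of_nonneg_left ?_ hγ0.le
    calc x ^ δ ≤ x ^ (1 : ℝ) := Real.rpow_le_rpow_of_exponent_le hx (by linarith)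
      _ = x := Real.rpow_one x
  have hpow : ∀ (t : ℕ) (e : ℝ), ((2 : ℝ) ^ t) ^ e = (2 : ℝ) ^ (e * t) := by
    intro t e
    rw [← Real.rpow_natCast, ← Real.rpow_mul zero_le_two, mul_comm]
  have hq : ∀ (t : ℕ) (e : ℝ), ((2 : ℝ) ^ e) ^ t = (2 : ℝ) ^ (e * t) := by
    intro t e
    rw [← Real.rpow_natCast, ← Real.rpow_mul zero_le_two]
  have hterm1 : ∀ t : ℕ, ((2 : ℝ) ^ (t + 1)) ^ ω * (powSpread γ δ (2 ^ t) ^ 2 *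
      (powSpread γ δ (2 ^ t) ^ α)⁻¹) = (γ ^ 2 * (γ ^ α)⁻¹) * (2 ^ ω * q1 ^ t) := by
    intro t
    have h2 : ((2 : ℝ) ^ (δ * t)) ^ 2 = 2 ^ (δ * 2 * t) := by
      rw [← Real.rpow_natCast, ← Real.rpow_mul zero_le_two]
      congr 1
      push_cast
      ring
    have h3 : ((2 : ℝ) ^ (δ * t)) ^ α = 2 ^ (δ * α * t) := by
      rw [← Real.rpow_mul zero_le_two]
      congr 1
      ring
    have h4 : (2 : ℝ) ^ (ω * t) * (2 ^ (δ * 2 * t) * (2 ^ (δ * α * t))⁻¹)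
        = 2 ^ ((ω + δ * 2 - δ * α) * t) := by
      rw [← Real.rpow_neg zero_le_two, ← Real.rpow_add two_pos, ← Real.rpow_add two_pos]
      congr 1
      ring
    rw [hpow, powSpread, hpow, Real.mul_rpow hγ0.le (by positivity), mul_pow, h2, h3, hq1, hq,
      ← h4, mul_inv]
    push_cast
    rw [mul_add, mul_one, Real.rpow_add two_pos]
    ring
  have hterm2 : ∀ t : ℕ, ((2 : ℝ) ^ (t + 1)) ^ σ * (γ ^ 2 *
      (powSpread γ δ (2 ^ t) ^ α)⁻¹) = (γ ^ 2 * (γ ^ α)⁻¹) * (2 ^ σ * q2 ^ t) := by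
    intro t
    have h3 : ((2 : ℝ) ^ (δ * t)) ^ α = 2 ^ (δ * α * t) := by
      rw [← Real.rpow_mul zero_le_two]
      congr 1
      ring
    have h4 : (2 : ℝ) ^ (σ * t) * (2 ^ (δ * α * t))⁻¹ = 2 ^ ((σ - δ * α) * t) := by
      rw [← Real.rpow_neg zero_le_two, ← Real.rpow_add two_pos]
      congr 1
      ring
    rw [hpow, powSpread, hpow, Real.mul_rpow hγ0.le (by positivity), h3, hq2, hq,
      ← h4, mul_inv]
    push_cast
    rw [mul_add, mul_one, Real.rpow_add two_pos]
    ring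
  have hsm1 : Summable fun t : ℕ => (γ ^ 2 * (γ ^ α)⁻¹) * (2 ^ ω * q1 ^ t) :=
    ((summable_geometric_of_lt_one hq10 hq1').mul_left _).mul_left _
  have hsm2 : Summable fun t : ℕ => (γ ^ 2 * (γ ^ α)⁻¹) * (2 ^ σ * q2 ^ t) :=
    ((summable_geometric_of_lt_one hq20 hq2').mul_left _).mul_left _
  refine feasibleWith_oblivious hL (η := ε / (1 + ε) / β) hβ hε hC hf1 hS
    (by rw [mul_div_cancel₀ _ hβ.ne']) hlim fun i hi F hF => ?_
  have hli := hL.pos i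
  have hshort := hL.sum_short_le hα hf hf1 (W := fun x => x ^ ω)
    (fun x hx y _ hxy => Real.rpow_le_rpow (zero_le_one.trans hx) hxy hω0)
    (fun x hx => Real.rpow_nonneg (zero_le_one.trans hx) _)
    (hsm1.congr fun t => (hterm1 t).symm) hS hi false (fun _ => true)
    (F.filter fun k => (L k).length ≤ (L i).length) (fun k hk => by
      obtain ⟨h1, h2⟩ := Finset.mem_filter.1 hk
      exact ⟨(hF k h1).1, (hF k h1).2, h2⟩)
  have hlong := hL.sum_long_le hα hf hγ hσ0 hf1 hfγ
    (hsm2.congr fun t => (hterm2 t).symm) hS hi false (fun _ => true)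
    (F.filter fun k => ¬ (L k).length ≤ (L i).length) (fun k hk => by
      obtain ⟨h1, h2⟩ := Finset.mem_filter.1 hk
      exact ⟨(hF k h1).1, (hF k h1).2.symm, (not_le.1 h2).le⟩)
  simp only [hterm1, hterm2, tsum_mul_left, tsum_geometric_of_lt_one hq10 hq1',
    tsum_geometric_of_lt_one hq20 hq2'] at hshort hlong
  set E := (L i).length ^ σ * ((L i).length ^ α)⁻¹ with hE
  have hE0 : 0 ≤ E := by positivity
  have hEω : E * (L i).length ^ ω = 1 := by
    rw [hE, ← Real.rpow_neg hli.le, ← Real.rpow_add hli, ← Real.rpow_add hli]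
    convert Real.rpow_zero _ using 2
    rw [hσ, hω]
    ring
  -- Factoring out E, the signal of i up to the constant C, puts the power of a shorter link into
  -- the form of `sum_short_le` with W(x) = x^ω.
  have hconv : ∀ k, (L k).length ^ σ = E * (((L i).length / (L k).length) ^ ω *
      (L k).length ^ α) := by
    intro k
    have hk := hL.pos k
    have h1 : ((L i).length / (L k).length) ^ ω * (L k).length ^ α
        = (L i).length ^ ω * (L k).length ^ σ := by
      rw [Real.div_rpow hli.le hk.le, div_mul_eq_mul_div, mul_div_assoc, ← Real.rpow_sub hk]
      congr 2
      rw [hσ, hω]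
      ring
    rw [h1, ← mul_assoc, hEω, one_mul]
  rw [← Finset.sum_filter_add_sum_filter_not F (fun k => (L k).length ≤ (L i).length)]
  calc _ ≤ E * (2 ^ α * spreadConst α * (γ ^ 2 * (γ ^ α)⁻¹ * (2 ^ ω * (1 - q1)⁻¹)))
        + spreadConst α * E * (γ ^ 2 * (γ ^ α)⁻¹ * (2 ^ σ * (1 - q2)⁻¹)) := by
        refine add_le_add ?_ hlong
        refine le_of_eq_of_le ?_ (mul_le_mul_of_nonneg_left hshort hE0)
        rw [Finset.mul_sum]
        refine Finset.sum_congr rfl fun k _ => ?_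
        rw [hconv k]
        simp only [Link.pt, if_true]
        simp only [Bool.false_eq_true, if_false]
        ring
    _ = ((2 ^ α * spreadConst α * (2 ^ ω * (1 - q1)⁻¹) + spreadConst α * (2 ^ σ * (1 - q2)⁻¹)) *
          (γ ^ 2 * (γ ^ α)⁻¹)) * E := by ring
    _ ≤ _ := mul_le_mul_of_nonneg_right hγη hE0

/-! ### Partition into independent sets -/

/-- Colour in order of decreasing l: each new element meets at most D conflicting ones already
coloured. `hr` serves ties, where the conflict may be recorded in the opposite direction. -/
theorem exists_greedy_coloring {ι : Type*} [Fintype ι] (l : ι → ℝ) (r : ι → ι → Prop)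
    (hr : ∀ i j, l i = l j → r i j → r j i) (D : ℕ)
    (hD : ∀ i, ∀ F : Finset ι, (∀ j ∈ F, j ≠ i ∧ l i ≤ l j ∧ r i j) → F.card ≤ D) :
    ∃ c : ι → Fin (D + 1), ∀ i j, i ≠ j → l i ≤ l j → r i j → c i ≠ c j := by
  classical
  suffices h : ∀ s : Finset ι, ∃ c : ι → Fin (D + 1), ∀ i ∈ s, ∀ j ∈ s, i ≠ j → l i ≤ l j →
      r i j → c i ≠ c j by
    obtain ⟨c, hc⟩ := h Finset.univ
    exact ⟨c, fun i j => hc i (Finset.mem_univ i) j (Finset.mem_univ j)⟩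
  intro s
  refine Finset.induction_on_min_value l s ⟨fun _ => 0, by simp⟩ ?_
  · intro a s ha hmin ih
    obtain ⟨c, hc⟩ := ih
    set F := s.filter fun j => r a j with hF
    have hcard : F.card ≤ D := hD a F fun j hj => by
      obtain ⟨h1, h2⟩ := Finset.mem_filter.1 hj
      exact ⟨fun h => ha (h ▸ h1), hmin j h1, h2⟩
    obtain ⟨z, hz⟩ : ∃ z : Fin (D + 1), z ∉ F.image c := by
      by_contra hcon
      push Not at hcon
      have h1 : (Finset.univ : Finset (Fin (D + 1))).card ≤ (F.image c).card :=
        Finset.card_le_card fun z _ => hcon z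
      rw [Finset.card_univ, Fintype.card_fin] at h1
      have := Finset.card_image_le (s := F) (f := c)
      omega
    have hz' : ∀ j ∈ s, r a j → z ≠ c j := fun j hj hraj h =>
      hz (Finset.mem_image.2 ⟨j, Finset.mem_filter.2 ⟨hj, hraj⟩, h.symm⟩)
    have hne : ∀ j ∈ s, j ≠ a := fun j hj h => ha (h ▸ hj)
    refine ⟨Function.update c a z, fun i hi j hj hij hle hrij => ?_⟩
    rcases Finset.mem_insert.1 hi with rfl | hi'
    · rcases Finset.mem_insert.1 hj with rfl | hj'
      · exact absurd rfl hij
      · rw [Function.update_self, Function.update_of_ne (hne j hj')]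
        exact hz' j hj' hrij
    · rcases Finset.mem_insert.1 hj with rfl | hj'
      · rw [Function.update_self, Function.update_of_ne (hne i hi')]
        exact (hz' i hi' (hr i _ (le_antisymm hle (hmin i hi')) hrij)).symm
      · rw [Function.update_of_ne (hne i hi'), Function.update_of_ne (hne j hj')]
        exact hc i hi' j hj' hij hle hrij

/-- Two links conflict if they are not far apart as in `IndepLinks`. -/
def LinkConflict {ι : Type*} (f : ℝ → ℝ) (L : ι → Link) (i j : ι) : Prop :=
  ∃ b b', dist ((L i).pt b) ((L j).pt b') ≤ (L i).length * f ((L j).length / (L i).length)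

/-- The values `x ∈ [1, Δ]` of a ratio of two lengths are grouped around the members of `X`. -/
def SpreadCover (f : ℝ → ℝ) (Δ R : ℝ) (X : Finset ℝ) : Prop :=
  ∀ x, 1 ≤ x → x ≤ Δ → ∃ y ∈ X, 1 ≤ y ∧ y ≤ x ∧ f x ≤ R * y

/-- Conflicting links assigned to y ∈ X have length at least y·l_i and an end within (R + 1)·y·l_i
of the sender of i, the extra 1 paying for the step between the ends of i. Packing bounds each such
group independently of y. -/
theorem SparseLinks.card_conflict_le {ι : Type*} {L : ι → Link} (hL : SparseLinks L) {f : ℝ → ℝ}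
    {Δ R : ℝ} {X : Finset ℝ} (hR : 0 ≤ R) (hX : SpreadCover f Δ R X)
    (hΔ : ∀ i j, (L j).length ≤ Δ * (L i).length) (i : ι) (F : Finset ι)
    (hF : ∀ j ∈ F, j ≠ i ∧ (L i).length ≤ (L j).length ∧ LinkConflict f L i j) :
    (F.card : ℝ) ≤ X.card * (10 ^ 4 * (R + 1) ^ 2) := by
  classical
  have hli := hL.pos i
  have h : ∀ j, ∃ (y : ℝ) (b : Bool), j ∈ F → y ∈ X ∧ 1 ≤ y ∧ y * (L i).length ≤ (L j).length ∧
      dist ((L j).pt b) (L i).sender ≤ (R + 1) * (y * (L i).length) := by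
    intro j
    by_cases hj : j ∈ F
    · obtain ⟨_, hle, b, b', hd⟩ := hF j hj
      obtain ⟨y, hyX, hy1, hyx, hfy⟩ := hX ((L j).length / (L i).length)
        ((one_le_div hli).2 hle) ((div_le_iff₀ hli).2 (hΔ i j))
      refine ⟨y, b', fun _ => ⟨hyX, hy1, (le_div_iff₀ hli).1 hyx, ?_⟩⟩
      have h1 : dist ((L i).pt b) (L i).sender ≤ (L i).length := by
        cases b
        · simp [Link.pt, Link.length, dist_comm]
        · simpa [Link.pt] using hli.le
      have h2 := dist_triangle ((L j).pt b') ((L i).pt b) (L i).sender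
      rw [dist_comm ((L j).pt b') ((L i).pt b)] at h2
      have h3 := mul_le_mul_of_nonneg_left hfy hli.le
      nlinarith
    · exact ⟨0, true, fun h => absurd h hj⟩
  choose y b hyb using h
  rw [Finset.card_eq_sum_card_fiberwise (f := y) (t := X) (fun j hj => (hyb j hj).1)]
  push_cast
  refine (Finset.sum_le_card_nsmul _ _ (10 ^ 4 * (R + 1) ^ 2) fun z hz => ?_).trans_eq
    (nsmul_eq_mul _ _)
  by_cases hz1 : 1 ≤ z
  · refine hL.card_le (l := z * (L i).length) (by positivity) (by linarith) (L i).sender b _ ?_ ?_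
    · intro j hj
      obtain ⟨hjF, rfl⟩ := Finset.mem_filter.1 hj
      exact (hyb j hjF).2.2.1
    · intro j hj
      obtain ⟨hjF, rfl⟩ := Finset.mem_filter.1 hj
      exact (hyb j hjF).2.2.2
  · rw [Finset.filter_false_of_mem]
    · simp only [Finset.card_empty, Nat.cast_zero]
      positivity
    · rintro j hj rfl
      exact hz1 (hyb j hj).2.1

theorem SparseLinks.exists_partition {ι : Type*} [Fintype ι] {L : ι → Link} (hL : SparseLinks L)
    {f : ℝ → ℝ} {Δ R : ℝ} {X : Finset ℝ} (hR : 0 ≤ R) (hX : SpreadCover f Δ R X)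
    (hΔ : ∀ i j, (L j).length ≤ Δ * (L i).length) {F : Finset ι → Prop}
    (hF : ∀ S, IndepLinks f L S → F S) :
    ∃ m : ℕ, (m : ℝ) ≤ X.card * (10 ^ 4 * (R + 1) ^ 2) + 1 ∧ SchedulableIn F m := by
  obtain ⟨c, hc⟩ := exists_greedy_coloring (fun i => (L i).length) (LinkConflict f L)
    (by
      rintro i j hij ⟨b, b', h⟩
      refine ⟨b', b, ?_⟩
      rw [dist_comm]
      change (L i).length = (L j).length at hij
      rw [hij] at h
      rw [hij]
      exact h)
    ⌊(X.card : ℝ) * (10 ^ 4 * (R + 1) ^ 2)⌋₊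
    (fun i F hF => Nat.le_floor (hL.card_conflict_le hR hX hΔ i F hF))
  refine ⟨_, ?_, c, fun t => hF _ fun i hi j hj hij hle b b' => ?_⟩
  · push_cast
    gcongr
    exact Nat.floor_le (by positivity)
  · rw [Finset.mem_filter] at hi hj
    by_contra hcon
    exact hc i j hij hle ⟨b, b', not_lt.1 hcon⟩ (hi.2.trans hj.2.symm)

/-! ### Towers of exponentials -/

/-- The tower of `m` twos. -/
def twoTower : ℕ → ℕ
  | 0 => 1
  | m + 1 => 2 ^ twoTower m

theorem one_le_twoTower (m : ℕ) : 1 ≤ twoTower m := by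
  cases m
  · exact le_rfl
  · exact Nat.one_le_two_pow

theorem le_twoTower_of_iterate_logb_le {k : ℕ} : ∀ {x : ℝ}, (Real.logb 2)^[k] x ≤ 1 →
    x ≤ twoTower k := by
  induction k with
  | zero =>
    intro x hx
    simpa [twoTower] using hx
  | succ k ih =>
    intro x hx
    rw [Function.iterate_succ_apply] at hx
    rcases le_or_gt x 0 with h0 | h0
    · exact h0.trans (Nat.cast_nonneg _)
    · have := ih hx
      rw [Real.logb_le_iff_le_rpow one_lt_two h0, Real.rpow_natCast] at this
      simpa [twoTower] using this

theorem le_twoTower_logStar (x : ℝ) : x ≤ twoTower (logStar x) := by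
  classical
  exact le_twoTower_of_iterate_logb_le (Nat.find_spec (exists_iterate_logb_le_one x))

theorem cube_le_two_pow_two_pow {T : ℕ} (hT : 1 ≤ T) : T ^ 3 ≤ 2 ^ 2 ^ T := by
  obtain ⟨k, rfl⟩ := Nat.exists_eq_add_of_le' hT
  have h1 : ∀ k : ℕ, k * 3 ≤ 2 ^ (k + 1) := by
    intro k
    induction k with
    | zero => simp
    | succ k ih =>
      rcases k with _ | _ | k
      · norm_num
      · norm_num
      · have := pow_succ 2 (k + 2 + 1)
        omega
  calc (k + 1) ^ 3 ≤ (2 ^ k) ^ 3 := Nat.pow_le_pow_left k.lt_two_pow_self 3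
    _ = 2 ^ (k * 3) := (pow_mul _ _ _).symm
    _ ≤ _ := Nat.pow_le_pow_right two_pos (h1 k)

theorem cube_le_twoTower (n : ℕ) : (n : ℝ) ^ 3 ≤ twoTower (logStar n + 2) := by
  have h : n ≤ twoTower (logStar n) := by exact_mod_cast le_twoTower_logStar n
  exact_mod_cast (Nat.pow_le_pow_left h 3).trans (cube_le_two_pow_two_pow (one_le_twoTower _))

theorem one_le_logStar {n : ℕ} (hn : 3 ≤ n) : 1 ≤ logStar n := by
  by_contra h
  have h0 : logStar n = 0 := by omega
  have h1 := le_twoTower_logStar n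
  rw [h0] at h1
  have h2 : (3 : ℝ) ≤ n := by exact_mod_cast hn
  norm_num [twoTower] at h1
  omega

/-! ### Covers for the two spread functions -/

theorem exists_logb_rpow_le {p q : ℝ} (hp : 0 < p) (hq : 0 ≤ q) :
    ∃ R : ℝ, 0 ≤ R ∧ ∀ y : ℝ, 1 ≤ y → (1 + q * Real.logb 2 y) ^ p ≤ R * y := by
  have hl2 : 0 < Real.log 2 := Real.log_pos one_lt_two
  refine ⟨(1 + q * p / Real.log 2) ^ p, by positivity, fun y hy => ?_⟩
  have hy0 : 0 < y := by linarith
  have h1 : Real.log y ≤ p * y ^ (1 / p) := by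
    have := Real.log_le_rpow_div hy0.le (one_div_pos.2 hp)
    rwa [div_div_eq_mul_div, div_one, mul_comm] at this
  have h2 : 1 ≤ y ^ (1 / p) := Real.one_le_rpow hy (one_div_pos.2 hp).le
  have h3 : 1 + q * Real.logb 2 y ≤ (1 + q * p / Real.log 2) * y ^ (1 / p) := by
    rw [Real.logb, add_mul, one_mul]
    refine add_le_add h2 ?_
    rw [mul_div_assoc', div_mul_eq_mul_div, mul_assoc]
    gcongr
  have h4 : 0 ≤ Real.logb 2 y := Real.logb_nonneg one_lt_two hy
  calc (1 + q * Real.logb 2 y) ^ p ≤ ((1 + q * p / Real.log 2) * y ^ (1 / p)) ^ p :=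
        Real.rpow_le_rpow (by positivity) h3 hp.le
    _ = _ := by
        rw [Real.mul_rpow (by positivity) (by positivity), ← Real.rpow_mul hy0.le,
          one_div_mul_cancel hp.ne', Real.rpow_one]

/-- Between consecutive towers T ≤ x ≤ 2^T, two representatives suffice. Up to T^q, f(x) is
polylogarithmic in T, hence O(T); beyond it, log x ≤ T gives f(x) = O(T^p), which is O(T^q). -/
theorem exists_spreadCover_log {γ p : ℝ} (hγ : 1 ≤ γ) (hp : 0 < p) :
    ∃ R : ℝ, 0 ≤ R ∧ ∀ M : ℕ, ∃ X : Finset ℝ, X.card ≤ 2 * (M + 1) ∧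
      SpreadCover (logSpread γ p) (twoTower M) R X := by
  classical
  set q := max p 1 with hq
  have hq1 : 1 ≤ q := le_max_right _ _
  have hqp : p ≤ q := le_max_left _ _
  obtain ⟨R₀, hR₀, hR⟩ := exists_logb_rpow_le hp (zero_le_one.trans hq1)
  have hγ0 : 0 < γ := by linarith
  refine ⟨γ * (R₀ + 2 ^ p), by positivity, fun M => ⟨(Finset.range (M + 1)).image
    (fun m => (twoTower m : ℝ)) ∪ (Finset.range (M + 1)).image (fun m => (twoTower m : ℝ) ^ q),
    ?_, fun x hx hxM => ?_⟩⟩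
  · refine (Finset.card_union_le _ _).trans ?_
    have h1 := Finset.card_image_le (s := Finset.range (M + 1)) (f := fun m => (twoTower m : ℝ))
    have h2 := Finset.card_image_le (s := Finset.range (M + 1))
      (f := fun m => (twoTower m : ℝ) ^ q)
    rw [Finset.card_range] at h1 h2
    omega
  obtain ⟨m, hmM, hm1, hm2⟩ : ∃ m ≤ M, (twoTower m : ℝ) ≤ x ∧
      x ≤ 2 ^ (twoTower m : ℝ) := by
    have hex : ∃ m, x ≤ twoTower m := ⟨M, hxM⟩
    have hspec := Nat.find_spec hex
    have hleM : Nat.find hex ≤ M := Nat.find_min' hex hxM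
    rcases hk : Nat.find hex with _ | k
    · rw [hk] at hspec
      simp only [twoTower, Nat.cast_one] at hspec
      refine ⟨0, Nat.zero_le _, ?_, ?_⟩
      · simpa [twoTower] using hx
      · simp only [twoTower, Nat.cast_one, Real.rpow_one]
        linarith
    · refine ⟨k, by omega, (not_le.1 (Nat.find_min hex (by omega))).le, ?_⟩
      rw [hk] at hspec
      simpa [twoTower] using hspec
  set T : ℝ := (twoTower m : ℝ) with hT
  have hT1 : 1 ≤ T := Nat.one_le_cast.2 (one_le_twoTower m)
  have hT0 : 0 < T := by linarith
  have hx0 : 0 < x := by linarith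
  have hlogx : 0 ≤ Real.logb 2 x := Real.logb_nonneg one_lt_two hx
  have hmem : m ∈ Finset.range (M + 1) := Finset.mem_range.2 (by omega)
  by_cases hxT : x ≤ T ^ q
  · refine ⟨T, Finset.mem_union_left _ (Finset.mem_image.2 ⟨m, hmem, rfl⟩), hT1, hm1, ?_⟩
    have h1 : Real.logb 2 x ≤ q * Real.logb 2 T := by
      rw [← Real.logb_rpow_eq_mul_logb_of_pos hT0]
      exact Real.logb_le_logb_of_le one_lt_two hx0 hxT
    have h2 : (1 + Real.logb 2 x) ^ p ≤ R₀ * T :=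
      (Real.rpow_le_rpow (by linarith) (by linarith) hp.le).trans (hR T hT1)
    rw [logSpread, mul_assoc]
    refine mul_le_mul_of_nonneg_left (h2.trans ?_) hγ0.le
    gcongr
    exact le_add_of_nonneg_right (by positivity)
  · refine ⟨T ^ q, Finset.mem_union_right _ (Finset.mem_image.2 ⟨m, hmem, rfl⟩),
      Real.one_le_rpow hT1 (by linarith), (not_le.1 hxT).le, ?_⟩
    have h1 : Real.logb 2 x ≤ T := (Real.logb_le_iff_le_rpow one_lt_two hx0).2 hm2
    have h2 : (1 + Real.logb 2 x) ^ p ≤ 2 ^ p * T ^ q := by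
      calc _ ≤ (2 * T) ^ p := Real.rpow_le_rpow (by linarith) (by linarith) hp.le
        _ = 2 ^ p * T ^ p := Real.mul_rpow zero_le_two hT0.le
        _ ≤ _ := by
          gcongr
    rw [logSpread, mul_assoc]
    refine mul_le_mul_of_nonneg_left (h2.trans ?_) hγ0.le
    gcongr
    exact le_add_of_nonneg_left hR₀

/-- Each representative 2^((1/δ)^m) is the δ-th power of the next, so x^δ is at most the last
representative below x. The point 1 handles x ≤ 2. -/
theorem exists_spreadCover_pow {γ δ : ℝ} (hγ : 1 ≤ γ) (hδ : 0 < δ) (hδ1 : δ < 1) (M : ℕ) :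
    ∃ X : Finset ℝ, X.card ≤ M + 2 ∧
      SpreadCover (powSpread γ δ) (2 ^ ((1 / δ) ^ M)) (2 * γ) X := by
  classical
  have hγ0 : 0 < γ := by linarith
  refine ⟨insert 1 ((Finset.range (M + 1)).image fun m => (2 : ℝ) ^ ((1 / δ) ^ m)), ?_,
    fun x hx hxM => ?_⟩
  · refine (Finset.card_insert_le _ _).trans ?_
    have h1 := Finset.card_image_le (s := Finset.range (M + 1))
      (f := fun m => (2 : ℝ) ^ ((1 / δ) ^ m))
    rw [Finset.card_range] at h1
    omega
  have hx0 : 0 < x := by linarith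
  have hex : ∃ m : ℕ, x ≤ (2 : ℝ) ^ ((1 / δ) ^ m) := ⟨M, hxM⟩
  have hspec := Nat.find_spec hex
  have hleM : Nat.find hex ≤ M := Nat.find_min' hex hxM
  rcases hk : Nat.find hex with _ | k
  · rw [hk, pow_zero, Real.rpow_one] at hspec
    refine ⟨1, Finset.mem_insert_self _ _, le_rfl, hx, ?_⟩
    have h1 : x ^ δ ≤ 2 := by
      calc x ^ δ ≤ x ^ (1 : ℝ) := Real.rpow_le_rpow_of_exponent_le hx hδ1.le
        _ ≤ 2 := by rwa [Real.rpow_one]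
    rw [powSpread]
    nlinarith
  · have hmin := (not_le.1 (Nat.find_min hex (m := k) (by omega))).le
    have hpos : (0 : ℝ) < (1 / δ) ^ k := by positivity
    refine ⟨2 ^ ((1 / δ) ^ k), Finset.mem_insert_of_mem (Finset.mem_image_of_mem _
      (Finset.mem_range.2 (by omega))), Real.one_le_rpow one_le_two hpos.le, hmin, ?_⟩
    rw [hk] at hspec
    have h1 : x ^ δ ≤ 2 ^ ((1 / δ) ^ k) := by
      calc x ^ δ ≤ ((2 : ℝ) ^ ((1 / δ) ^ (k + 1))) ^ δ := Real.rpow_le_rpow hx0.le hspec hδ.le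
        _ = _ := by
          rw [← Real.rpow_mul zero_le_two, pow_succ, mul_assoc, one_div_mul_cancel hδ.ne', mul_one]
    have h2 : (0 : ℝ) < 2 ^ ((1 / δ) ^ k) := by positivity
    rw [powSpread]
    nlinarith [mul_le_mul_of_nonneg_left h1 hγ0.le, mul_pos hγ0 h2]

theorem exists_loglog_bound {δ : ℝ} (hδ : 0 < δ) (hδ1 : δ < 1) :
    ∃ A : ℝ, 0 < A ∧ ∀ n : ℕ, 3 ≤ n → ∃ M : ℕ, (n : ℝ) ^ 3 ≤ 2 ^ ((1 / δ) ^ M) ∧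
      ((M + 2 : ℕ) : ℝ) ≤ A * Real.log (Real.log n) := by
  have hl2 : 0 < Real.log 2 := Real.log_pos one_lt_two
  have hl2' : Real.log 2 < 1 := by
    have := Real.log_two_lt_d9
    linarith
  have hld : 0 < Real.log (1 / δ) := Real.log_pos ((one_lt_div hδ).2 hδ1)
  have hl3 : 1 < Real.log 3 := by
    rw [Real.lt_log_iff_exp_lt (by norm_num)]
    have := Real.exp_one_lt_d9
    linarith
  set u := Real.log (Real.log 3) with hu
  have hu0 : 0 < u := Real.log_pos hl3
  set v := Real.log (3 / Real.log 2) with hv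
  have hv0 : 0 < v := Real.log_pos ((one_lt_div hl2).2 (by linarith))
  -- As log log n ≥ u = log log 3 > 0, additive constants are absorbed after division by u; the 3 is
  -- the 2 of the statement plus the rounding of M.
  refine ⟨(v / Real.log (1 / δ) + 3) / u + 1 / Real.log (1 / δ), by positivity, fun n hn => ?_⟩
  have hn3 : (3 : ℝ) ≤ n := by exact_mod_cast hn
  have hn0 : (0 : ℝ) < n := by linarith
  have hln : Real.log 3 ≤ Real.log n := Real.log_le_log (by norm_num) hn3
  have hln0 : 0 < Real.log n := by linarith
  set w := Real.log (Real.log n) with hw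
  have huw : u ≤ w := Real.log_le_log (by linarith) hln
  have hz : 0 < (v + w) / Real.log (1 / δ) := div_pos (by linarith) hld
  refine ⟨⌈(v + w) / Real.log (1 / δ)⌉₊, ?_, ?_⟩
  · have h1 : v + w ≤ ⌈(v + w) / Real.log (1 / δ)⌉₊ * Real.log (1 / δ) :=
      (div_le_iff₀ hld).1 (Nat.le_ceil _)
    set M := ⌈(v + w) / Real.log (1 / δ)⌉₊
    rw [← Real.log_pow, hv, hw, ← Real.log_mul (by positivity) hln0.ne',
      Real.log_le_log_iff (by positivity) (by positivity), div_mul_eq_mul_div,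
      div_le_iff₀ hl2] at h1
    rw [← Real.log_le_log_iff (by positivity) (by positivity), Real.log_pow,
      Real.log_rpow two_pos]
    exact_mod_cast h1
  · have h1 := (Nat.ceil_lt_add_one hz.le).le
    have h2 : v / Real.log (1 / δ) + 3 ≤ (v / Real.log (1 / δ) + 3) / u * w := by
      rw [div_mul_eq_mul_div, le_div_iff₀ hu0]
      gcongr
    rw [add_div] at h1
    push_cast
    rw [add_mul, one_div_mul_eq_div]
    rw [add_div]
    linarith

/-! ### Random deployments -/

/-- By independence and Fubini, fix the i-th point: the j-th must fall in a disk of radius δ, whose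
area is compared with the lower bound V for the area of Q. -/
theorem uniformDeployment_close_le {n : ℕ} {Q : Set Plane}
    [MeasureTheory.IsProbabilityMeasure (ProbabilityTheory.cond MeasureTheory.volume Q)]
    (hQ : MeasurableSet Q) {V : ENNReal} (hV : V ≤ MeasureTheory.volume Q) (δ : ℝ)
    {i j : Fin n} (hij : i ≠ j) :
    uniformDeployment n Q {x | dist (x i) (x j) < δ} ≤
      ENNReal.ofReal δ ^ 2 * ENNReal.ofReal Real.pi / V := by
  set ν := ProbabilityTheory.cond MeasureTheory.volume Q with hν
  have hi' : Measurable fun x : Fin n → Plane => x i := measurable_pi_apply i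
  have hj' : Measurable fun x : Fin n → Plane => x j := measurable_pi_apply j
  have hind : ProbabilityTheory.IndepFun (fun x : Fin n → Plane => x i) (fun x => x j)
      (MeasureTheory.Measure.pi fun _ => ν) :=
    (ProbabilityTheory.iIndepFun_pi (μ := fun _ : Fin n => ν)
    (X := fun _ => id) (fun _ => aemeasurable_id)).indepFun hij
  rw [ProbabilityTheory.indepFun_iff_map_prod_eq_prod_map_map
    hi'.aemeasurable hj'.aemeasurable] at hind
  have hi : (MeasureTheory.Measure.pi fun _ : Fin n => ν).map (fun x => x i) = ν :=
    (MeasureTheory.measurePreserving_eval (fun _ : Fin n => ν) i).map_eq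
  have hj : (MeasureTheory.Measure.pi fun _ : Fin n => ν).map (fun x => x j) = ν :=
    (MeasureTheory.measurePreserving_eval (fun _ : Fin n => ν) j).map_eq
  rw [hi, hj] at hind
  have hopen : MeasurableSet {z : Plane × Plane | dist z.1 z.2 < δ} :=
    (isOpen_lt (continuous_fst.dist continuous_snd) continuous_const).measurableSet
  have h1 : uniformDeployment n Q {x | dist (x i) (x j) < δ} =
      (ν.prod ν) {z | dist z.1 z.2 < δ} := by
    rw [← hind, MeasureTheory.Measure.map_apply
      (hi'.prodMk hj') hopen]
    rfl
  rw [h1, MeasureTheory.Measure.prod_apply hopen]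
  have h2 : ∀ p : Plane, ν (Prod.mk p ⁻¹' {z | dist z.1 z.2 < δ}) ≤
      ENNReal.ofReal δ ^ 2 * ENNReal.ofReal Real.pi / V := by
    intro p
    have h3 : Prod.mk p ⁻¹' {z | dist z.1 z.2 < δ} = Metric.ball p δ := by
      ext q
      simp [dist_comm]
    rw [h3, hν, ProbabilityTheory.cond_apply hQ, mul_comm, ← div_eq_mul_inv]
    refine ENNReal.div_le_div ?_ hV
    exact (MeasureTheory.measure_mono Set.inter_subset_right).trans
      (EuclideanSpace.volume_ball_fin_two p δ).le
  refine (MeasureTheory.lintegral_mono h2).trans_eq ?_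
  rw [MeasureTheory.lintegral_const, MeasureTheory.measure_univ, mul_one]

theorem region_bounds {a : ℝ} (ha : 0 < a) {Q : Set Plane}
    (hQ : IsSquareOfSide a Q ∨ IsDiskOfRadius a Q) :
    IsClosed Q ∧ (∃ p, Metric.ball p (a / 2) ⊆ Q) ∧ ∀ u ∈ Q, ∀ v ∈ Q, dist u v ≤ 2 * a := by
  rcases hQ with ⟨φ, rfl⟩ | ⟨p, rfl⟩
  · refine ⟨?_, ⟨φ (WithLp.toLp 2 fun _ => a / 2), ?_⟩, ?_⟩
    · refine φ.toHomeomorph.isClosedMap _ ?_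
      rw [Set.ofPred_forall]
      exact isClosed_iInter fun i => isClosed_Icc.preimage (by fun_prop)
    · rw [← φ.image_ball]
      refine Set.image_mono fun x hx i => ?_
      rw [Metric.mem_ball, dist_eq_norm] at hx
      have h1 := (PiLp.norm_apply_le (x - WithLp.toLp 2 fun _ => a / 2) i).trans_lt hx
      rw [PiLp.sub_apply, Real.norm_eq_abs, abs_lt] at h1
      exact ⟨by linarith [h1.1], by linarith [h1.2]⟩
    · rintro _ ⟨u, hu, rfl⟩ _ ⟨v, hv, rfl⟩
      rw [φ.dist_eq, EuclideanSpace.dist_eq, Real.sqrt_le_left (by positivity), Fin.sum_univ_two]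
      have key : ∀ i : Fin 2, dist (u i) (v i) ^ 2 ≤ a ^ 2 := by
        intro i
        refine pow_le_pow_left₀ dist_nonneg ?_ 2
        obtain ⟨h1, h2⟩ := hu i
        obtain ⟨h3, h4⟩ := hv i
        rw [Real.dist_eq, abs_le]
        constructor <;> linarith
      nlinarith [key 0, key 1, sq_nonneg a]
  · refine ⟨Metric.isClosed_closedBall, ⟨p, ?_⟩, fun u hu v hv => ?_⟩
    · exact (Metric.ball_subset_ball (by linarith)).trans Metric.ball_subset_closedBall
    · have := dist_triangle_right u v p
      rw [Metric.mem_closedBall] at hu hv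
      linarith

/-- With high probability, no two of the nodes are close together. -/
theorem uniformDeployment_bad_le {n : ℕ} (hn : 3 ≤ n) {a : ℝ} (ha : 0 < a) {Q : Set Plane}
    (hQ : IsSquareOfSide a Q ∨ IsDiskOfRadius a Q) :
    uniformDeployment n Q {x | ¬ ((∀ i j, dist (x i) (x j) ≤ 2 * a) ∧
      ∀ i j, i ≠ j → a / n ^ 2 ≤ dist (x i) (x j))} ≤ ENNReal.ofReal (4 / (n : ℝ) ^ 2) := by
  classical
  obtain ⟨hclosed, ⟨p, hball⟩, hdist⟩ := region_bounds ha hQ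
  have hn0 : (0 : ℝ) < n := by
    have : (3 : ℝ) ≤ n := by exact_mod_cast hn
    linarith
  have hvol : ENNReal.ofReal (Real.pi * (a / 2) ^ 2) ≤ MeasureTheory.volume Q := by
    refine le_trans (le_of_eq ?_) (MeasureTheory.measure_mono hball)
    rw [EuclideanSpace.volume_ball_fin_two, ← ENNReal.ofReal_pow (by positivity),
      ← ENNReal.ofReal_mul (by positivity), mul_comm]
  have hVpos : 0 < Real.pi * (a / 2) ^ 2 := by positivity
  have hfin : MeasureTheory.volume Q ≠ ⊤ :=
    (Metric.isBounded_iff.2 ⟨2 * a, fun u hu v hv => hdist u hu v hv⟩).measure_lt_top.ne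
  have hne : MeasureTheory.volume Q ≠ 0 := fun h => by
    rw [h, nonpos_iff_eq_zero, ENNReal.ofReal_eq_zero] at hvol
    linarith
  have := ProbabilityTheory.cond_isProbabilityMeasure_of_finite hne hfin
  have hmem : ∀ᵐ x ∂(uniformDeployment n Q), ∀ i, x i ∈ Q := by
    rw [MeasureTheory.ae_all_iff]
    intro i
    exact (MeasureTheory.measurePreserving_eval
      (fun _ : Fin n => ProbabilityTheory.cond MeasureTheory.volume Q) i).quasiMeasurePreserving.ae
      (ProbabilityTheory.ae_cond_mem hclosed.measurableSet)
  set δ := a / (n : ℝ) ^ 2 with hδ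
  set I := (Finset.univ : Finset (Fin n × Fin n)).filter fun z => z.1 ≠ z.2 with hI
  have hIcard : (I.card : ℝ) ≤ (n : ℝ) ^ 2 := by
    have : I.card ≤ n * n := by
      refine (Finset.card_filter_le _ _).trans ?_
      simp
    rw [pow_two]
    exact_mod_cast this
  calc _ ≤ uniformDeployment n Q (⋃ z ∈ I, {x | dist (x z.1) (x z.2) < δ}) := by
        refine MeasureTheory.measure_mono_ae ?_
        filter_upwards [hmem] with x hx hbad
        change ¬ _ at hbad
        change x ∈ (⋃ z ∈ I, {x : Fin n → Plane | dist (x z.1) (x z.2) < δ})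
        by_contra hcon
        refine hbad ⟨fun i j => hdist _ (hx i) _ (hx j), fun i j hij => ?_⟩
        by_contra hlt
        refine hcon (Set.mem_iUnion₂.2 ⟨(i, j), ?_, not_le.1 hlt⟩)
        rw [hI, Finset.mem_filter]
        exact ⟨Finset.mem_univ _, hij⟩
    _ ≤ ∑ z ∈ I, uniformDeployment n Q {x | dist (x z.1) (x z.2) < δ} :=
        MeasureTheory.measure_biUnion_finset_le _ _
    _ ≤ ∑ _z ∈ I, ENNReal.ofReal δ ^ 2 * ENNReal.ofReal Real.pi /
          ENNReal.ofReal (Real.pi * (a / 2) ^ 2) := by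
        refine Finset.sum_le_sum fun z hz => ?_
        exact uniformDeployment_close_le hclosed.measurableSet hvol δ (Finset.mem_filter.1 hz).2
    _ = ENNReal.ofReal (I.card * (δ ^ 2 * Real.pi / (Real.pi * (a / 2) ^ 2))) := by
        rw [Finset.sum_const, nsmul_eq_mul, ← ENNReal.ofReal_pow (by positivity),
          ← ENNReal.ofReal_mul (by positivity), ← ENNReal.ofReal_div_of_pos hVpos,
          ENNReal.ofReal_mul (Nat.cast_nonneg _), ENNReal.ofReal_natCast]
    _ ≤ _ := by
        refine ENNReal.ofReal_le_ofReal ?_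
        calc _ ≤ (n : ℝ) ^ 2 * (δ ^ 2 * Real.pi / (Real.pi * (a / 2) ^ 2)) := by gcongr
          _ = 4 / (n : ℝ) ^ 2 := by
            rw [hδ]
            field_simp
            norm_num

theorem mainTheorem5 (α β ε : ℝ) (hα : 2 < α) (hβ : 0 < β) (hε : 0 < ε) :
    ∃ τ : ℝ, 0 < τ ∧ τ < 1 ∧ ∃ K : ℝ, 0 < K ∧
      ∀ n : ℕ, 3 ≤ n → ∀ a : ℝ, 0 < a →
        ∀ Q : Set Plane, IsSquareOfSide a Q ∨ IsDiskOfRadius a Q →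
          ∀ N : ℝ, 0 ≤ N →
            uniformDeployment n Q
              {x | ¬ ∀ T : SimpleGraph (Fin n), IsMST x T →
                  ∀ o : T.edgeSet → Fin n × Fin n, IsOrientation T o →
                    (∃ m : ℕ, (m : ℝ) ≤ K * (logStar n : ℝ) ∧
                      GlobalSchedule α β N ε (treeLinks x T o) m) ∧
                    (∃ m : ℕ, (m : ℝ) ≤ K * Real.log (Real.log n) ∧
                      ObliviousSchedule α β N ε τ (treeLinks x T o) m)}
              ≤ ENNReal.ofReal (K / (n : ℝ) ^ 2) := by
  obtain ⟨γ₁, hγ₁, hglob⟩ := exists_global_feasible hα hβ hε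
  obtain ⟨R₁, hR₁, hcov₁⟩ := exists_spreadCover_log hγ₁ (p := 2 / (α - 2))
    (div_pos two_pos (by linarith))
  obtain ⟨τ, hτ0, hτ1, δ, hδ0, hδ1, γ₂, hγ₂, hobl⟩ := exists_oblivious_feasible hα hβ hε
  obtain ⟨A, hA, hloglog⟩ := exists_loglog_bound hδ0 hδ1
  set D₁ : ℝ := 10 ^ 4 * (R₁ + 1) ^ 2 with hD₁
  set D₂ : ℝ := 10 ^ 4 * (2 * γ₂ + 1) ^ 2 with hD₂
  have hD₁0 : 0 ≤ D₁ := by positivity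
  have hD₂0 : 0 ≤ D₂ := by positivity
  refine ⟨τ, hτ0, hτ1, 4 + (8 * D₁ + 1) + A * (D₂ + 1), by positivity,
    fun n hn a ha Q hQ N hN => ?_⟩
  set K := 4 + (8 * D₁ + 1) + A * (D₂ + 1) with hK
  have hK1 : 8 * D₁ + 1 ≤ K := by
    have : 0 ≤ A * (D₂ + 1) := by positivity
    linarith
  have hK2 : A * (D₂ + 1) ≤ K := by linarith
  have hK4 : 4 ≤ K := by
    have : 0 ≤ A * (D₂ + 1) := by positivity
    linarith
  have hn3 : (3 : ℝ) ≤ n := by exact_mod_cast hn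
  -- Only monotonicity is used, so the scheduling event need not be measurable.
  refine le_trans (MeasureTheory.measure_mono ?_) ((uniformDeployment_bad_le hn ha hQ).trans
    (ENNReal.ofReal_le_ofReal (by gcongr)))
  intro x hx hgood
  obtain ⟨hmax, hmin⟩ := hgood
  refine hx fun T hT o ho => ?_
  have hδpos : 0 < a / (n : ℝ) ^ 2 := by positivity
  have hinj : Function.Injective x := by
    intro i j hij
    by_contra hne
    have := hmin i j hne
    rw [hij, dist_self] at this
    linarith
  have hL := hT.sparseLinks hinj ho
  have hΔ : ∀ i j, (treeLinks x T o j).length ≤ (n : ℝ) ^ 3 * (treeLinks x T o i).length := by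
    intro i j
    have hne : (o i).1 ≠ (o i).2 := by
      intro h
      have := hL.pos i
      simp [treeLinks, Link.length, h] at this
    have h1 : (treeLinks x T o j).length ≤ 2 * a := hmax _ _
    have h2 : a / (n : ℝ) ^ 2 ≤ (treeLinks x T o i).length := hmin _ _ hne
    calc _ ≤ 2 * a := h1
      _ ≤ n * a := by gcongr; linarith
      _ = (n : ℝ) ^ 3 * (a / (n : ℝ) ^ 2) := by field_simp
      _ ≤ _ := by gcongr
  have hpos := fun i => (hL.pos i).le
  let _ := Fintype.ofFinite T.edgeSet
  constructor
  · obtain ⟨X, hXcard, hX⟩ := hcov₁ (logStar n + 2)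
    obtain ⟨m, hm, hs⟩ := hL.exists_partition hR₁ hX
      (fun i j => (hΔ i j).trans (mul_le_mul_of_nonneg_right (cube_le_twoTower n) (hpos i)))
      (F := Feasible α β N ε (treeLinks x T o)) (fun S hS => hglob _ _ hL N hN S hS)
    refine ⟨m, hm.trans ?_, hs⟩
    have h1 := one_le_logStar hn
    have h2 : (X.card : ℝ) ≤ 8 * logStar n := by
      have : X.card ≤ 8 * logStar n := by omega
      exact_mod_cast this
    have h3 : (1 : ℝ) ≤ logStar n := by exact_mod_cast h1
    calc X.card * D₁ + 1 ≤ 8 * logStar n * D₁ + logStar n := by gcongr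
      _ = (8 * D₁ + 1) * logStar n := by ring
      _ ≤ _ := by gcongr
  · obtain ⟨M, hM, hMA⟩ := hloglog n hn
    obtain ⟨X, hXcard, hX⟩ := exists_spreadCover_pow hγ₂ hδ0 hδ1 M
    obtain ⟨m, hm, c, hc⟩ := hL.exists_partition (by linarith : 0 ≤ 2 * γ₂) hX
      (fun i j => (hΔ i j).trans (mul_le_mul_of_nonneg_right hM (hpos i)))
      -- Partitioning into independent rather than feasible sets yields one colouring that serves
      -- every C.
      (F := IndepLinks (powSpread γ₂ δ) (treeLinks x T o)) (fun S hS => hS)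
    refine ⟨m, hm.trans ?_, fun C hC hlim => ⟨c, fun t => hobl _ _ hL N C hC _ (hc t)
      fun i _ => hlim i (Finset.mem_univ i)⟩⟩
    have h2 : (X.card : ℝ) ≤ A * Real.log (Real.log n) :=
      le_trans (by exact_mod_cast hXcard) hMA
    have h3 : 1 ≤ A * Real.log (Real.log n) := by
      refine le_trans ?_ hMA
      push_cast
      have : (0 : ℝ) ≤ M := Nat.cast_nonneg _
      linarith
    have h4 : 0 ≤ Real.log (Real.log n) := by
      by_contra h
      have := mul_neg_of_pos_of_neg hA (not_le.1 h)
      linarith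
    calc X.card * D₂ + 1 ≤ A * Real.log (Real.log n) * D₂ + A * Real.log (Real.log n) := by
          gcongr
      _ = A * (D₂ + 1) * Real.log (Real.log n) := by ring
      _ ≤ _ := by gcongr
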